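/- Let $\eta$ be a random variable with values in $\{0,1,2,\dots\}$ such that $\mathbf P[\eta\ge 1]>0$ and $\mathbf E\eta<\infty$. For $d\ge 1$ and $p\in[0,1]$, consider the frog model with death on $\mathbb Z^d$ (nearest-neighbour graph, root $\mathbf 0$): independently over all sites $x$, there are initially $\eta(x)$ particles at $x$, where $\eta(x)$ has the law of $\eta$; to each particle are attached, independently of everything else, a simple random walk $(S_n)_{n\ge 0}$ on $\mathbb Z^d$ starting from the site of the particle and a lifetime $\Xi$ with $\mathbf P[\Xi=k]=(1-p)p^{k-1}$, $k=1,2,\dots$ (and $\Xi=\infty$ if $p=1$). At time $0$ the particles at $\mathbf 0$ are active and all others are sleeping. A particle activated at time $T$ is active at the times $T+n$ with $0\le n<\Xi$, is then at the site $S_n$, and activates all sleeping particles at the sites where it is; at time $T+\Xi$ it disappears. The process survives if at every time $n=0,1,2,\dots$ there is at least one active particle. Let $$p_c(\mathbb Z^d,\eta)=\inf\{p\in[0,1]:\ \mathbf P[\text{the process with parameter } p \text{ survives}]>0\}.$$ Then $$\lim_{d\to\infty}p_c(\mathbb Z^d,\eta)=\frac1{1+\mathbf E\eta}.$$ -/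

import Mathlib

open MeasureTheory ProbabilityTheory Filter Topology

noncomputable section

namespace Frog

/-- The sites of the lattice `ℤ^d`. -/
abbrev Site (d : ℕ) : Type := Fin d → ℤ

/-- The nearest neighbours of the origin of `ℤ^d`: the vectors of `ℓ¹`-norm one
(see `mem_unitSteps`). -/
def unitSteps (d : ℕ) : Finset (Site d) :=
  (Fintype.piFinset fun _ : Fin d => Finset.Icc (-1 : ℤ) 1).filter fun z => ∑ i, |z i| = 1

theorem mem_unitSteps {d : ℕ} {z : Site d} : z ∈ unitSteps d ↔ ∑ i, |z i| = 1 := by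
  simp only [unitSteps, Finset.mem_filter, Fintype.mem_piFinset, Finset.mem_Icc,
    and_iff_right_iff_imp]
  intro h i
  rw [← abs_le, ← h]
  exact Finset.single_le_sum (f := fun j => |z j|) (fun j _ => abs_nonneg _) (Finset.mem_univ i)

theorem unitSteps_nonempty {d : ℕ} (hd : 0 < d) : (unitSteps d).Nonempty := by
  refine ⟨Pi.single ⟨0, hd⟩ 1, mem_unitSteps.2 ?_⟩
  rw [Finset.sum_eq_single (⟨0, hd⟩ : Fin d)]
  · simp
  · intro j _ hj
    simp [Pi.single_eq_of_ne hj]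
  · simp

open Classical in
/-- The law of one step of simple random walk on `ℤ^d`: uniform on the `2d` neighbours of the
origin. (For `d = 0` there is no neighbour, and the walk does not move.) -/
def stepLaw (d : ℕ) : Measure (Site d) :=
  (if h : (unitSteps d).Nonempty then PMF.uniformOfFinset (unitSteps d) h
    else PMF.pure 0).toMeasure

instance (d : ℕ) : IsProbabilityMeasure (stepLaw d) := by
  unfold stepLaw; infer_instance

open Classical in
/-- The law of the lifetime `Ξ` of a particle: `P[Ξ = k] = (1 - p) p ^ (k - 1)` for
`k = 1, 2, …` if `p < 1`, and `Ξ = ∞` if `p = 1`. Mathlib's `geometricMeasure q` gives mass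
`(1 - q) ^ n * q` to `n = 0, 1, …`; here `q = 1 - p`, shifted by one. -/
def lifetimeLaw (p : unitInterval) : Measure ℕ∞ :=
  if p = 1 then Measure.dirac ⊤
  else (geometricMeasure (unitInterval.symm p)).map fun n : ℕ => ((n + 1 : ℕ) : ℕ∞)

instance (p : unitInterval) : IsProbabilityMeasure (lifetimeLaw p) := by
  unfold lifetimeLaw
  split_ifs
  · infer_instance
  · exact Measure.isProbabilityMeasure_map (by fun_prop)

/-- A realization of all the randomness of the frog model on `ℤ^d`: the numbers `η(x)` of
particles, the successive steps of the walk of each particle `(x, i)`, and the lifetime of each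
particle `(x, i)`. Particles at `x` are numbered `i = 0, 1, …`; those with `i < η(x)` exist. -/
abbrev Config (d : ℕ) : Type :=
  (Site d → ℕ) × (Site d × ℕ → ℕ → Site d) × (Site d × ℕ → ℕ∞)

/-- The law of the frog model on `ℤ^d` with survival parameter `p` and with `η` of law `ν`: all
the variables `η(x)`, all the steps and all the lifetimes are independent. -/
def frogLaw (d : ℕ) (p : unitInterval) (ν : Measure ℕ) [IsProbabilityMeasure ν] :
    Measure (Config d) :=
  (Measure.infinitePi fun _ : Site d => ν).prod
    ((Measure.infinitePi fun _ : Site d × ℕ => Measure.infinitePi fun _ : ℕ => stepLaw d).prod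
      (Measure.infinitePi fun _ : Site d × ℕ => lifetimeLaw p))

variable {d : ℕ}

/-- The initial number `η(x)` of particles at `x`. -/
def count (ω : Config d) (x : Site d) : ℕ := ω.1 x

/-- The position `S_n^x(i)`, `n` steps after activation, of the `i`-th particle from `x`. -/
def walk (ω : Config d) (x : Site d) (i n : ℕ) : Site d := x + ∑ k ∈ Finset.range n, ω.2.1 (x, i) k

/-- The lifetime `Ξ^x(i)` of the `i`-th particle from `x`. -/
def lifetime (ω : Config d) (x : Site d) (i : ℕ) : ℕ∞ := ω.2.2 (x, i)

/-- `t(x, y)`: the least `n` such that some particle from `x` is at `y`, still alive, `n` steps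
after activation; infinite if there is none. -/
def passageTime (ω : Config d) (x y : Site d) : ℕ∞ :=
  ⨅ (i : ℕ) (_ : i < count ω x) (n : ℕ) (_ : (n : ℕ∞) < lifetime ω x i ∧ walk ω x i n = y),
    (n : ℕ∞)

/-- `T(x)`: the moment when the particles at `x` are awakened, that is, the infimum of
`t(x_0, x_1) + ⋯ + t(x_{m-1}, x_m)` over the finite sequences `0 = x_0, x_1, …, x_m = x`. -/
def activationTime (ω : Config d) (x : Site d) : ℕ∞ :=
  ⨅ (m : ℕ) (s : ℕ → Site d) (_ : s 0 = 0 ∧ s m = x),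
    ∑ j ∈ Finset.range m, passageTime ω (s j) (s (j + 1))

/-- The `i`-th particle from `x` exists, has been activated by time `n`, and is still alive. -/
def IsActive (ω : Config d) (n : ℕ) (x : Site d) (i : ℕ) : Prop :=
  i < count ω x ∧ activationTime ω x ≤ n ∧ (n : ℕ∞) < activationTime ω x + lifetime ω x i

/-- At every instant of time there is at least one active particle. -/
def Survives (ω : Config d) : Prop := ∀ n : ℕ, ∃ x i, IsActive ω n x i

/-- The critical parameter `p_c(ℤ^d, η)`, where `ν` is the law of `η`. -/
def criticalParam (d : ℕ) (ν : Measure ℕ) [IsProbabilityMeasure ν] : ℝ :=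
  sInf {p : ℝ | ∃ hp : p ∈ Set.Icc (0 : ℝ) 1, 0 < frogLaw d ⟨p, hp⟩ ν {ω | Survives ω}}

end Frog

end

/-!
A particle visits on average at most `p / (1 - p)` sites after its first one, so the expected number
of chains of `n` visits to new sites is at most `(Eη * p / (1 - p)) ^ n`. This is summable if
`p < 1 / (1 + Eη)`; then only finitely many sites are ever activated and the process dies out.

If `p > 1 / (1 + Eη)`, the chains grow exponentially as long as no visit leads to a site that is
already activated, and in high dimension such collisions are rare. Project `ℤ^d` to `ℤ²` by summing
the first `q` coordinates and the next `q` coordinates, where `q / d` is small and fixed. Most steps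
are neutral, that is, they do not change the projection. In each fibre (layer) the activated sites
are explored along neutral steps for a bounded number of generations; with high probability their
number becomes so large that, for each of the next layers `z + (1, 0)` and `z + (0, 1)`, many of the
particles there enter it with their first step. Since different layers use different particles, the
reached layers dominate an oriented percolation in which a layer fails with small probability, even
given the past, and a Peierls argument over the contours of a finite cluster shows that infinitely
many layers are reached with positive probability.
-/

namespace Frog

open Measure
open scoped ENNReal

section Independence

variable {ι : Type*} {X : ι → Type*} [∀ i, MeasurableSpace (X i)]

theorem measurableSet_iSup_comap_eval_of_dependsOn {A : Set (Π i, X i)} (mA : MeasurableSet A)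
    {S : Set ι} (hA : DependsOn (· ∈ A) S) :
    MeasurableSet[⨆ i ∈ S, MeasurableSpace.comap (fun ω : Π i, X i => ω i) inferInstance] A := by
  classical
  rcases A.eq_empty_or_nonempty with rfl | ⟨x, -⟩
  · exact @MeasurableSet.empty _ (_)
  let truncate : (Π i, X i) → Π i, X i := fun ω i => if i ∈ S then ω i else x i
  have hpre : truncate ⁻¹' A = A := by
    ext ω
    exact iff_of_eq (hA fun i hi => if_pos hi)
  have hm : Measurable[⨆ i ∈ S, MeasurableSpace.comap (fun ω : Π i, X i => ω i) inferInstance]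
      truncate := by
    refine @measurable_pi_lambda _ _ _ (_) _ _ fun i => ?_
    by_cases hi : i ∈ S
    · simp only [truncate, hi, if_true]
      exact Measurable.mono (comap_measurable _) (le_iSup₂_of_le i hi le_rfl) le_rfl
    · simp only [truncate, hi, if_false]
      exact @measurable_const _ _ _ (_) _
  rw [← hpre]
  exact hm mA

variable (P : (i : ι) → Measure (X i)) [∀ i, IsProbabilityMeasure (P i)]

theorem infinitePi_inter_of_dependsOn {A B : Set (Π i, X i)} (mA : MeasurableSet A)
    (mB : MeasurableSet B) {S T : Set ι} (hST : Disjoint S T)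
    (hA : DependsOn (· ∈ A) S) (hB : DependsOn (· ∈ B) T) :
    infinitePi P (A ∩ B) = infinitePi P A * infinitePi P B :=
  (Indep_iff _ _ _).1
    (indep_iSup_of_disjoint (fun _ => (measurable_pi_apply _).comap_le)
      (iIndepFun_infinitePi (X := fun _ => id) fun _ => measurable_id) hST) A B
    (measurableSet_iSup_comap_eval_of_dependsOn mA hA)
    (measurableSet_iSup_comap_eval_of_dependsOn mB hB)

/-- If, once a discrete variable `g` has taken the value `c`, the event `Bad c` involves only
coordinates that have not been looked at, then it keeps its unconditional probability. -/
theorem infinitePi_inter_adapted_le {T : Type*} [Countable T] [MeasurableSpace T]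
    [MeasurableSingletonClass T] {g : (Π i, X i) → T} (hg : Measurable g) {Q : Set (Π i, X i)}
    (mQ : MeasurableSet Q) {Bad : T → Set (Π i, X i)} (mBad : ∀ c, MeasurableSet (Bad c))
    (U : T → Set ι) (δ : ℝ≥0∞)
    (h : ∀ c, (Q ∩ g ⁻¹' {c}).Nonempty → DependsOn (· ∈ Q ∩ g ⁻¹' {c}) (U c)ᶜ ∧
      DependsOn (· ∈ Bad c) (U c) ∧ infinitePi P (Bad c) ≤ δ) :
    infinitePi P (Q ∩ {ω | ω ∈ Bad (g ω)}) ≤ δ * infinitePi P Q := by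
  have mQg : ∀ c, MeasurableSet (Q ∩ g ⁻¹' {c}) := fun c =>
    mQ.inter (hg (measurableSet_singleton c))
  calc infinitePi P (Q ∩ {ω | ω ∈ Bad (g ω)})
      = infinitePi P (⋃ c, Q ∩ g ⁻¹' {c} ∩ Bad c) := by congr 1; ext ω; simp
    _ ≤ ∑' c, infinitePi P (Q ∩ g ⁻¹' {c} ∩ Bad c) := measure_iUnion_le _
    _ ≤ ∑' c, δ * infinitePi P (Q ∩ g ⁻¹' {c}) := by
        refine ENNReal.tsum_le_tsum fun c => ?_
        rcases (Q ∩ g ⁻¹' {c}).eq_empty_or_nonempty with h0 | h0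
        · simp [h0]
        · obtain ⟨hQ, hB, hδ⟩ := h c h0
          rw [infinitePi_inter_of_dependsOn P (mQg c) (mBad c) disjoint_compl_left hQ hB, mul_comm]
          gcongr
    _ = δ * infinitePi P (⋃ c, Q ∩ g ⁻¹' {c}) := by
        rw [ENNReal.tsum_mul_left, measure_iUnion _ mQg]
        exact fun c c' hcc => Set.disjoint_left.2 fun ω h1 h2 => hcc (h1.2.symm.trans h2.2)
    _ = δ * infinitePi P Q := by congr 2; ext ω; simp

end Independence

theorem infinitePi_map_zip {ι X Y : Type*} [MeasurableSpace X] [MeasurableSpace Y]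
    (P : ι → Measure X) [∀ i, IsProbabilityMeasure (P i)]
    (Q : ι → Measure Y) [∀ i, IsProbabilityMeasure (Q i)] :
    ((infinitePi P).prod (infinitePi Q)).map (fun f i => (f.1 i, f.2 i))
      = infinitePi fun i => (P i).prod (Q i) := by
  refine eq_infinitePi _ fun s t ht => ?_
  let zip := (MeasurableEquiv.arrowProdEquivProdArrow X Y s).symm
  have hzip : MeasurePreserving zip _ _ :=
    (measurePreserving_arrowProdEquivProdArrow X Y s (fun i => P i) fun i => Q i).symm
  have mt : MeasurableSet (Set.univ.pi fun i : s => t i) := .univ_pi fun i => ht i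
  rw [map_apply (by fun_prop) (.pi s.countable_toSet fun i _ => ht i)]
  calc (infinitePi P).prod (infinitePi Q) ((fun f i => (f.1 i, f.2 i)) ⁻¹' (s : Set ι).pi t)
      = ((infinitePi P).prod (infinitePi Q)).map (Prod.map s.restrict s.restrict)
          (zip ⁻¹' Set.univ.pi fun i : s => t i) := by
        rw [map_apply (by fun_prop) (zip.measurable mt)]
        congr 1
        ext f
        simp [zip, MeasurableEquiv.arrowProdEquivProdArrow]
    _ = ∏ i ∈ s, ((P i).prod (Q i)) (t i) := by
        rw [← map_prod_map _ _ (by fun_prop) (by fun_prop), infinitePi_map_restrict,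
          infinitePi_map_restrict, hzip.measure_preimage mt.nullMeasurableSet, pi_pi]
        exact Finset.prod_coe_sort s fun i => ((P i).prod (Q i)) (t i)

theorem measurable_of_countable_bind {Ω β γ : Type*} [MeasurableSpace Ω] [MeasurableSpace β]
    [MeasurableSpace γ] [Countable β] [MeasurableSingletonClass β] {f : Ω → β} (hf : Measurable f)
    {F : β → Ω → γ} (hF : ∀ b, Measurable (F b)) : Measurable fun ω => F (f ω) ω :=
  (measurable_from_prod_countable_right (f := fun q : β × Ω => F q.1 q.2) hF).comp
    (hf.prodMk measurable_id)

theorem exists_injOn_path {α : Type*} {R : α → α → Prop} {a b : α}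
    (h : Relation.ReflTransGen R a b) :
    ∃ (n : ℕ) (f : ℕ → α), f 0 = a ∧ f n = b ∧ (∀ i < n, R (f i) (f (i + 1))) ∧
      Set.InjOn f (Set.Iic n) := by
  induction h with
  | refl =>
    exact ⟨0, fun _ => a, rfl, rfl, by simp,
      fun i hi j hj _ => (Nat.le_zero.1 hi).trans (Nat.le_zero.1 hj).symm⟩
  | @tail x y _ hxy ih =>
    obtain ⟨n, f, h0, hn, hf, hinj⟩ := ih
    by_cases hy : ∃ i ≤ n, f i = y
    · obtain ⟨i, hi, rfl⟩ := hy
      exact ⟨i, f, h0, rfl, fun j hj => hf j (hj.trans_le hi), hinj.mono (Set.Iic_subset_Iic.2 hi)⟩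
    · push Not at hy
      refine ⟨n + 1, Function.update f (n + 1) y, by simpa using h0, by simp, fun i hi => ?_, ?_⟩
      · rcases Nat.lt_succ_iff_lt_or_eq.1 hi with hi | rfl
        · simpa [Function.update, hi.ne, (hi.trans n.lt_succ_self).ne] using hf i hi
        · simpa [Function.update, hn] using hxy
      · intro i hi j hj hij
        rcases Nat.le_succ_iff.1 hi with hi | rfl <;> rcases Nat.le_succ_iff.1 hj with hj | rfl
        · rw [Function.update_of_ne (by omega), Function.update_of_ne (by omega)] at hij
          exact hinj hi hj hij
        · rw [Function.update_of_ne (by omega), Function.update_self] at hij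
          exact absurd hij (hy i hi)
        · rw [Function.update_self, Function.update_of_ne (by omega)] at hij
          exact absurd hij.symm (hy j hj)
        · rfl

theorem sum_le_sum_sub_of_closed {G : Type*} [AddGroup G] {R : Finset G} {J : G → ℤ} {e : G}
    (hfwd : ∀ v ∈ R, 0 < J v → v + e ∈ R) (hbwd : ∀ v ∈ R, J (v - e) < 0 → v - e ∈ R) :
    ∑ v ∈ R, J v ≤ ∑ v ∈ R, J (v - e) := by
  classical
  let R' := R.image (· - e)
  have hout : ∑ u ∈ R \ R', J u ≤ 0 := Finset.sum_nonpos fun u hu => by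
    obtain ⟨huR, huR'⟩ := Finset.mem_sdiff.1 hu
    by_contra! hJ
    exact huR' (Finset.mem_image.2 ⟨u + e, hfwd u huR hJ, add_sub_cancel_right u e⟩)
  have hin : 0 ≤ ∑ u ∈ R' \ R, J u := Finset.sum_nonneg fun u hu => by
    obtain ⟨huR', huR⟩ := Finset.mem_sdiff.1 hu
    obtain ⟨v, hv, rfl⟩ := Finset.mem_image.1 huR'
    by_contra! hJ
    exact huR (hbwd v hv hJ)
  have hR' : ∑ v ∈ R, J (v - e) = ∑ u ∈ R', J u :=
    (Finset.sum_image fun x _ y _ h => sub_left_injective h).symm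
  have := Finset.sum_sdiff_sub_sum_sdiff (s₁ := R') (s₂ := R) (f := J)
  rw [hR']
  linarith

noncomputable section Contours

/-- The directions of the steps of a dual path of `ℤ²`. The dual vertex `(a, b)` stands for the
point `(a - 1/2, b - 1/2)`. -/
inductive Direction
  | up | left | down | right
  deriving DecidableEq

namespace Direction

instance : Fintype Direction := ⟨{up, left, down, right}, by rintro (_ | _ | _ | _) <;> decide⟩

/-- The displacement made by a dual step. -/
def vec : Direction → ℤ × ℤ
  | up => (0, 1) | left => (-1, 0) | down => (0, -1) | right => (1, 0)

/-- The site on the left-hand side of the dual step that starts at `v`. -/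
def leftSite (v : ℤ × ℤ) : Direction → ℤ × ℤ
  | up => v - (1, 0) | left => v - (1, 1) | down => v - (0, 1) | right => v

/-- The site on the right-hand side of the dual step that starts at `v`. -/
def rightSite (v : ℤ × ℤ) : Direction → ℤ × ℤ
  | up => v | left => v - (1, 0) | down => v - (1, 1) | right => v - (0, 1)

end Direction

open Direction Relation

/-- A step of a contour of `W`: a dual step in the upper half-plane that has `W` on its left-hand
side only. -/
def ContourStep (W : Set (ℤ × ℤ)) (v v' : ℤ × ℤ) : Prop :=
  ∃ c : Direction, v' = v + c.vec ∧ c.leftSite v ∈ W ∧ c.rightSite v ∉ W ∧ 0 ≤ (c.rightSite v).2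

variable {W : Set (ℤ × ℤ)}

theorem nonneg_of_contourStep (hpos : ∀ z ∈ W, 0 ≤ z) {v v' : ℤ × ℤ} (h : ContourStep W v v') :
    0 ≤ v' := by
  obtain ⟨c, rfl, hl, -, hr⟩ := h
  have := hpos _ hl
  cases c <;> simp_all [Prod.le_def, vec, leftSite, rightSite] <;> omega

theorem nonneg_of_contour (hpos : ∀ z ∈ W, 0 ≤ z) {s v : ℤ × ℤ} (hs : 0 ≤ s)
    (h : ReflTransGen (ContourStep W) s v) : 0 ≤ v := by
  obtain rfl | ⟨u, -, hu⟩ := ReflTransGen.cases_tail h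
  exacts [hs, nonneg_of_contourStep hpos hu]

theorem finite_contour (hfin : W.Finite) (s : ℤ × ℤ) :
    {v | ReflTransGen (ContourStep W) s v}.Finite := by
  have hends : {v | ∃ u, ContourStep W u v}.Finite := by
    refine (Set.finite_iUnion fun c : Direction =>
      hfin.image fun z => z - c.leftSite 0 + c.vec).subset ?_
    rintro v ⟨u, c, rfl, hl, -⟩
    refine Set.mem_iUnion.2 ⟨c, _, hl, ?_⟩
    cases c <;> ext <;> simp [leftSite]
  refine (hends.insert s).subset fun v hv => ?_
  obtain rfl | ⟨u, -, hu⟩ := ReflTransGen.cases_tail hv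
  exacts [Set.mem_insert _ _, Set.mem_insert_of_mem _ ⟨u, hu⟩]

open Classical in
/-- The signed number of contour steps of `W` along the vertical dual edge from `v` to
`v + (0, 1)`. -/
def upFlow (W : Set (ℤ × ℤ)) (v : ℤ × ℤ) : ℤ := W.indicator 1 (v - (1, 0)) - W.indicator 1 v

open Classical in
/-- The signed number of contour steps of `W` along the horizontal dual edge from `v` to
`v + (1, 0)`. -/
def rightFlow (W : Set (ℤ × ℤ)) (v : ℤ × ℤ) : ℤ :=
  if 1 ≤ v.2 then W.indicator 1 v - W.indicator 1 (v - (0, 1)) else 0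

/-- The net number of contour steps of `W` that leave the dual vertex `v`. -/
def netFlow (W : Set (ℤ × ℤ)) (v : ℤ × ℤ) : ℤ :=
  upFlow W v - upFlow W (v - (0, 1)) + (rightFlow W v - rightFlow W (v - (1, 0)))

theorem netFlow_eq_zero {v : ℤ × ℤ} (hv : 1 ≤ v.2) : netFlow W v = 0 := by
  obtain ⟨a, b⟩ := v
  have hv : 1 ≤ b := hv
  simp only [netFlow, upFlow, rightFlow, Prod.mk_sub_mk, sub_zero, if_pos hv]
  ring

theorem netFlow_bottom (hpos : ∀ z ∈ W, 0 ≤ z) (a : ℤ) :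
    netFlow W (a, 0) = W.indicator 1 (a - 1, 0) - W.indicator 1 (a, 0) := by
  have hbelow : ∀ x : ℤ, W.indicator 1 (x, -1) = (0 : ℤ) := fun x =>
    Set.indicator_of_notMem (fun h => by simpa using (hpos _ h).2) _
  simp [netFlow, upFlow, rightFlow, hbelow]

theorem netFlow_nonneg (hpos : ∀ z ∈ W, 0 ≤ z)
    (hpred : ∀ z ∈ W, z ≠ 0 → z - (1, 0) ∈ W ∨ z - (0, 1) ∈ W) {v : ℤ × ℤ} (h1 : v.1 ≠ 0)
    (h2 : 0 ≤ v.2) : 0 ≤ netFlow W v := by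
  obtain ⟨a, b⟩ := v
  rcases (show 0 ≤ b from h2).eq_or_lt with rfl | hb
  · rw [netFlow_bottom hpos, sub_nonneg]
    by_cases ha : (a, 0) ∈ W
    · rcases hpred _ ha (by simpa using h1) with h | h
      · simp_all
      · simpa using (hpos _ h).2
    · rw [Set.indicator_of_notMem ha]
      exact Set.indicator_nonneg (by simp) _
  · exact (netFlow_eq_zero (v := (a, b)) hb).ge

theorem indicator_one_lt_iff {α : Type*} {W : Set α} {x y : α} :
    (W.indicator 1 y : ℤ) < W.indicator 1 x ↔ x ∈ W ∧ y ∉ W := by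
  by_cases hx : x ∈ W <;> by_cases hy : y ∈ W <;> simp [hx, hy]

theorem sum_upFlow_le {R : Finset (ℤ × ℤ)}
    (hR : ∀ v ∈ R, ∀ v', ContourStep W v v' → v' ∈ R)
    (hpos : ∀ z ∈ W, 0 ≤ z) (hR2 : ∀ v ∈ R, 0 ≤ v.2) :
    ∑ v ∈ R, upFlow W v ≤ ∑ v ∈ R, upFlow W (v - (0, 1)) := by
  refine sum_le_sum_sub_of_closed (fun v hv hJ => ?_) fun v hv hJ => ?_
  · obtain ⟨hl, hr⟩ := indicator_one_lt_iff.1 (sub_pos.1 hJ)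
    exact hR v hv _ ⟨up, rfl, hl, hr, hR2 v hv⟩
  · obtain ⟨hl, hr⟩ := indicator_one_lt_iff.1 (sub_neg.1 hJ)
    refine hR v hv _ ⟨down, by ext <;> simp [vec, sub_eq_add_neg], hl, ?_, (hpos _ hl).2⟩
    simpa [rightSite, sub_sub] using hr

theorem sum_rightFlow_le {R : Finset (ℤ × ℤ)}
    (hR : ∀ v ∈ R, ∀ v', ContourStep W v v' → v' ∈ R) :
    ∑ v ∈ R, rightFlow W v ≤ ∑ v ∈ R, rightFlow W (v - (1, 0)) := by
  refine sum_le_sum_sub_of_closed (fun v hv hJ => ?_) fun v hv hJ => ?_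
  · have h2 : 1 ≤ v.2 := by
      by_contra h
      simp [rightFlow, h] at hJ
    rw [rightFlow, if_pos h2, sub_pos] at hJ
    obtain ⟨hl, hr⟩ := indicator_one_lt_iff.1 hJ
    exact hR v hv _ ⟨right, rfl, hl, hr, sub_nonneg.2 h2⟩
  · have h2 : 1 ≤ (v - (1, 0)).2 := by
      by_contra h
      simp only [rightFlow, if_neg h, lt_self_iff_false] at hJ
    rw [rightFlow, if_pos h2, sub_neg] at hJ
    obtain ⟨hl, hr⟩ := indicator_one_lt_iff.1 hJ
    refine hR v hv _ ⟨left, by ext <;> simp [vec, sub_eq_add_neg], ?_, hr, zero_le_one.trans h2⟩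
    simpa [leftSite, sub_sub] using hl

/-- If no reachable dual vertex were on the axis, the net flow out of the set of reachable
vertices would be positive because of the edge `s`, whereas the flow never leaves this set. -/
theorem exists_contour_to_axis (hfin : W.Finite) (hpos : ∀ z ∈ W, 0 ≤ z)
    (hpred : ∀ z ∈ W, z ≠ 0 → z - (1, 0) ∈ W ∨ z - (0, 1) ∈ W) {a : ℤ}
    (ha : (a - 1, 0) ∈ W) (ha' : (a, 0) ∉ W) :
    ∃ v : ℤ × ℤ, v.1 = 0 ∧ ReflTransGen (ContourStep W) (a, 0) v := by
  by_contra! hcon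
  let R := (finite_contour hfin (a, 0)).toFinset
  have memR : ∀ v, v ∈ R ↔ ReflTransGen (ContourStep W) (a, 0) v := by simp [R]
  have ha0 : (0 : ℤ × ℤ) ≤ (a, 0) := ⟨(hpos _ ha).1.trans (sub_le_self a zero_le_one), le_rfl⟩
  have hR2 : ∀ v ∈ R, 0 ≤ v.2 := fun v hv => (nonneg_of_contour hpos ha0 ((memR v).1 hv)).2
  have hR : ∀ v ∈ R, ∀ v', ContourStep W v v' → v' ∈ R := fun v hv v' h =>
    (memR v').2 (((memR v).1 hv).tail h)
  have hflow : ∑ v ∈ R, netFlow W v ≤ 0 := by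
    simp only [netFlow, Finset.sum_add_distrib, Finset.sum_sub_distrib]
    linarith [sum_upFlow_le hR hpos hR2, sum_rightFlow_le hR]
  have hstart : netFlow W (a, 0) = 1 := by simp [netFlow_bottom hpos, ha, ha']
  have hle : netFlow W (a, 0) ≤ ∑ v ∈ R, netFlow W v :=
    Finset.single_le_sum (fun v hv => netFlow_nonneg hpos hpred (fun h => hcon v h ((memR v).1 hv))
      (hR2 v hv)) ((memR _).2 .refl)
  omega

/-- The vertices of the dual path that starts at `(k + 1, 0)` and has the directions `w`. -/
def contourVertex (k : ℕ) {n : ℕ} (w : Fin n → Direction) (i : Fin (n + 1)) : ℤ × ℤ :=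
  ((k : ℤ) + 1, 0) + Fin.partialSum (fun j => (w j).vec) i

/-- The sites on the left-hand side of the upward and leftward steps of a dual path: along a
contour of `W` these are the sites of `W` that have a successor outside `W`. -/
def contourExits (k : ℕ) {n : ℕ} (w : Fin n → Direction) : Finset (ℤ × ℤ) :=
  ({i | w i = up ∨ w i = left} : Finset (Fin n)).image fun i =>
    (w i).leftSite (contourVertex k w i.castSucc)

section Word

variable {k n : ℕ} {w : Fin n → Direction}

theorem contourVertex_succ (i : Fin n) :
    contourVertex k w i.succ = contourVertex k w i.castSucc + (w i).vec := by
  rw [contourVertex, Fin.partialSum_succ, ← add_assoc, ← contourVertex]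

theorem contourVertex_last :
    contourVertex k w (Fin.last n) = ((k : ℤ) + 1, 0) + ∑ i, (w i).vec := by
  simp [contourVertex, Fin.partialSum, List.take_of_length_le, List.sum_ofFn]

theorem lt_length_of_contourVertex_last (h : (contourVertex k w (Fin.last n)).1 = 0) : k < n := by
  have hvec : ∀ c : Direction, -1 ≤ c.vec.1 := by decide
  have hsum : -(n : ℤ) ≤ ∑ i, (w i).vec.1 := by
    simpa using Finset.card_nsmul_le_sum Finset.univ _ (-1) fun i _ => hvec (w i)
  rw [contourVertex_last, Prod.fst_add, Prod.fst_sum] at h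
  simp only at h
  omega

/-- Upward and leftward steps increase the difference of the coordinates, which is larger at the
end than at the start; the other steps decrease it. -/
theorem length_le_two_mul_card (h1 : (contourVertex k w (Fin.last n)).1 = 0)
    (h2 : 0 ≤ (contourVertex k w (Fin.last n)).2) :
    n ≤ 2 * ({i | w i = up ∨ w i = left} : Finset (Fin n)).card := by
  have hvec : ∀ c : Direction,
      c.vec.2 - c.vec.1 = 2 * (if c = up ∨ c = left then 1 else 0) - 1 := by
    decide
  have hsum : ∑ i, ((w i).vec.2 - (w i).vec.1)
      = 2 * (({i | w i = up ∨ w i = left} : Finset (Fin n)).card : ℤ) - n := by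
    simp only [hvec, Finset.sum_sub_distrib, ← Finset.mul_sum, Finset.sum_boole]
    simp
  rw [contourVertex_last, Prod.fst_add, Prod.fst_sum] at h1
  rw [contourVertex_last, Prod.snd_add, Prod.snd_sum] at h2
  rw [Finset.sum_sub_distrib] at hsum
  simp only at h1 h2
  omega

theorem card_le_two_mul_card_contourExits (hinj : Function.Injective (contourVertex k w)) :
    ({i | w i = up ∨ w i = left} : Finset (Fin n)).card ≤ 2 * (contourExits k w).card := by
  have hdir : ∀ c : Direction, c = up ∨ c = left →
      ({i | w i = c} : Finset (Fin n)).card ≤ (contourExits k w).card := fun c hc => by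
    refine Finset.card_le_card_of_injOn (fun i => c.leftSite (contourVertex k w i.castSucc))
      (fun i hi => ?_) fun i _ j _ hij => Fin.castSucc_injective n (hinj ?_)
    · have hi : w i = c := by simpa using hi
      exact Finset.mem_image.2 ⟨i, by simpa [hi] using hc, by rw [hi]⟩
    · rcases hc with rfl | rfl <;> exact sub_left_injective hij
  rw [Finset.filter_or]
  have := Finset.card_union_le ({i | w i = up} : Finset (Fin n)) {i | w i = left}
  have := hdir up (.inl rfl)
  have := hdir left (.inr rfl)
  omega

end Word

theorem exists_contour_word (hfin : W.Finite) (hpos : ∀ z ∈ W, 0 ≤ z)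
    (hpred : ∀ z ∈ W, z ≠ 0 → z - (1, 0) ∈ W ∨ z - (0, 1) ∈ W) {k : ℕ}
    (hk : ((k : ℤ), 0) ∈ W) (hk' : ((k : ℤ) + 1, 0) ∉ W) :
    ∃ (n : ℕ) (w : Fin n → Direction), Function.Injective (contourVertex k w) ∧
      (contourVertex k w (Fin.last n)).1 = 0 ∧ 0 ≤ (contourVertex k w (Fin.last n)).2 ∧
      ∀ i, (w i).leftSite (contourVertex k w i.castSucc) ∈ W ∧
        (w i).rightSite (contourVertex k w i.castSucc) ∉ W := by
  obtain ⟨v, hv0, hv⟩ := exists_contour_to_axis hfin hpos hpred (by simpa using hk) hk'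
  have hstart : (0 : ℤ × ℤ) ≤ ((k : ℤ) + 1, 0) := ⟨by positivity, le_rfl⟩
  have hvpos : 0 ≤ v := nonneg_of_contour hpos hstart hv
  obtain ⟨n, f, hf0, rfl, hstep, hinj⟩ := exists_injOn_path hv
  choose w hw hl hr _ using fun i : Fin n => hstep i i.2
  have hvertex : ∀ i : Fin (n + 1), contourVertex k w i = f i := fun i => by
    induction i using Fin.induction with
    | zero => simp [contourVertex, hf0]
    | succ i ih => rw [contourVertex_succ, ih, Fin.val_succ, hw i, Fin.val_castSucc]
  refine ⟨n, w, fun i j hij => ?_, ?_, ?_, fun i => ?_⟩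
  · rw [hvertex, hvertex] at hij
    exact Fin.ext (hinj (Nat.lt_succ_iff.1 i.2) (Nat.lt_succ_iff.1 j.2) hij)
  · rwa [hvertex]
  · rw [hvertex]
    exact hvpos.2
  · rw [hvertex]
    exact ⟨hl i, hr i⟩

theorem exists_bottom_right (hfin : W.Finite) (h0 : (0 : ℤ × ℤ) ∈ W) :
    ∃ k : ℕ, ((k : ℤ), 0) ∈ W ∧ ((k : ℤ) + 1, 0) ∉ W := by
  by_contra! hcon
  have hall : ∀ k : ℕ, ((k : ℤ), 0) ∈ W := fun k => by
    induction k with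
    | zero => exact h0
    | succ k ih => exact_mod_cast hcon k ih
  exact Set.infinite_of_injective_forall_mem (fun a b hab => by simpa using hab) hall hfin

theorem exists_contourExits (hfin : W.Finite) (h0 : (0 : ℤ × ℤ) ∈ W) (hpos : ∀ z ∈ W, 0 ≤ z)
    (hpred : ∀ z ∈ W, z ≠ 0 → z - (1, 0) ∈ W ∨ z - (0, 1) ∈ W) :
    ∃ n k : ℕ, k < n ∧ ∃ w : Fin n → Direction, n ≤ 4 * (contourExits k w).card ∧
      ∀ z ∈ contourExits k w, z ∈ W ∧ (z + (1, 0) ∉ W ∨ z + (0, 1) ∉ W) := by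
  obtain ⟨k, hk, hk'⟩ := exists_bottom_right hfin h0
  obtain ⟨n, w, hinj, h1, h2, hsides⟩ := exists_contour_word hfin hpos hpred hk hk'
  refine ⟨n, k, lt_length_of_contourVertex_last h1, w, ?_, fun z hz => ?_⟩
  · have := length_le_two_mul_card h1 h2
    have := card_le_two_mul_card_contourExits hinj
    omega
  · obtain ⟨i, hi, rfl⟩ := Finset.mem_image.1 hz
    obtain ⟨hl, hr⟩ := hsides i
    refine ⟨hl, ?_⟩
    rcases (Finset.mem_filter.1 hi).2 with hi | hi <;> rw [hi] at hr ⊢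
    · exact .inl (by simpa [leftSite, rightSite] using hr)
    · refine .inr fun h => hr ?_
      convert h using 1
      ext <;> simp [leftSite, rightSite]

end Contours

section Discrete

variable {S Ω : Type*} [MeasurableSpace Ω]

theorem measurable_biUnion [DecidableEq S] {ι : Type*} (s : Finset ι) {f : ι → Ω → Finset S}
    (hf : ∀ i, Measurable (f i)) : Measurable fun ω => s.biUnion fun i => f i ω := by
  refine measurable_finset_iff.2 fun a => ?_
  simp only [Finset.mem_biUnion, ← exists_prop, ← measurableSet_setOfPred, Set.ofPred_exists]
  exact .biUnion s.countable_toSet fun i _ =>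
    measurableSet_setOfPred.2 (measurable_finset_iff.1 (hf i) a)

open Classical in
/-- Some `M` elements of `B`; the empty set if there are fewer. -/
noncomputable def pick (M : ℕ) (B : Finset S) : Finset S :=
  if h : M ≤ B.card then (Finset.exists_subset_card_eq h).choose else ∅

theorem pick_subset (M : ℕ) (B : Finset S) : pick M B ⊆ B := by
  unfold pick
  split_ifs with h
  · exact (Finset.exists_subset_card_eq h).choose_spec.1
  · exact Finset.empty_subset B

theorem card_pick {M : ℕ} {B : Finset S} (h : M ≤ B.card) : (pick M B).card = M := by
  rw [pick, dif_pos h]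
  exact (Finset.exists_subset_card_eq h).choose_spec.2

theorem card_pick_of_nonempty {M : ℕ} {B : Finset S} (h : (pick M B).Nonempty) :
    (pick M B).card = M := by
  by_cases hM : M ≤ B.card
  · exact card_pick hM
  · simp [pick, hM] at h

theorem pick_nonempty {M : ℕ} (hM : 0 < M) {B : Finset S} (h : M ≤ B.card) :
    (pick M B).Nonempty := by
  rwa [← Finset.card_pos, card_pick h]

end Discrete

section Discovered

variable {S E : Type*} [DecidableEq S]

/-- All the sites discovered from the sites of `B`, each of which reveals the sites `X x e`,
where `e` is the data carried by `x`. -/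
def discovered (X : S → E → Finset S) (B : Finset S) (r : S → E) : Finset S :=
  B.biUnion fun x => X x (r x)

theorem discovered_congr {X : S → E → Finset S} {B : Finset S} {r r' : S → E}
    (h : ∀ x ∈ B, r x = r' x) : discovered X B r = discovered X B r' :=
  Finset.biUnion_congr rfl fun x hx => by rw [h x hx]

theorem measurable_discovered [MeasurableSpace E] {X : S → E → Finset S}
    (hX : ∀ x, Measurable (X x)) (B : Finset S) : Measurable (discovered X B) :=
  measurable_biUnion B fun x => (hX x).comp (measurable_pi_apply x)

end Discovered

/-- The unit vectors of `ℤ²`. -/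
def unitVec : Fin 2 → ℤ × ℤ := ![(1, 0), (0, 1)]

/-- The rules of an exploration of a set `S` of sites that are arranged in layers indexed by `ℤ²`
and carry data in `E`. A site `x` with data `e` reveals the sites `child x e` of its own layer, and
the sites `exit i x e` of the next layer in the direction `i`. A layer is explored for `gens`
generations, starting from `quota` sites. -/
structure LayeredRule (S E : Type*) [MeasurableSpace E] where
  layer : S → ℤ × ℤ
  child : S → E → Finset S
  exit : Fin 2 → S → E → Finset S
  gens : ℕ
  quota : ℕ
  layer_child : ∀ {x e y}, y ∈ child x e → layer y = layer x
  layer_exit : ∀ {i x e y}, y ∈ exit i x e → layer y = layer x + unitVec i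
  measurable_child : ∀ x, Measurable (child x)
  measurable_exit : ∀ i x, Measurable (exit i x)

namespace LayeredRule

variable {S E : Type*} [DecidableEq S] [MeasurableSpace E] (b : LayeredRule S E)

/-- The exploration of a layer from `A`: the sites whose data have been used, and the sites of the
current generation. -/
def explore (A : Finset S) (r : S → E) : ℕ → Finset S × Finset S
  | 0 => (∅, A)
  | j + 1 => ((explore A r j).1 ∪ (explore A r j).2,
      discovered b.child (explore A r j).2 r \ ((explore A r j).1 ∪ (explore A r j).2))

/-- The sites of the next layer in the direction `i` that are discovered by the last generation of
the exploration from `A`. -/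
def exits (i : Fin 2) (A : Finset S) (r : S → E) : Finset S :=
  discovered (b.exit i) (b.explore A r b.gens).2 r

/-- The exploration from `A` discovers sufficiently many sites of both next layers. -/
def Good (A : Finset S) (r : S → E) : Prop := ∀ i, b.quota ≤ (b.exits i A r).card

omit [DecidableEq S] in
/-- The site `x` reveals `y`, in its own layer or in a next one. -/
def Leads (r : S → E) (x y : S) : Prop :=
  y ∈ b.child x (r x) ∨ ∃ i, y ∈ b.exit i x (r x)

section Explore

theorem explore_congr {A : Finset S} {r r' : S → E} {j : ℕ}
    (h : ∀ x ∈ (b.explore A r j).1, r x = r' x) :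
    ∀ i ≤ j, b.explore A r i = b.explore A r' i := by
  induction j with
  | zero =>
    rintro i hi
    obtain rfl := Nat.le_zero.1 hi
    rfl
  | succ j ih =>
    have ih := ih fun x hx => h x (Finset.mem_union_left _ hx)
    intro i hi
    rcases Nat.le_succ_iff.1 hi with hi | rfl
    · exact ih i hi
    · have hchild : discovered b.child (b.explore A r j).2 r
          = discovered b.child (b.explore A r j).2 r' :=
        discovered_congr fun x hx => h x (Finset.mem_union_right _ hx)
      simp only [explore]
      rw [hchild, ih j le_rfl]

theorem disjoint_explore (A : Finset S) (r : S → E) (j : ℕ) :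
    Disjoint (b.explore A r j).1 (b.explore A r j).2 := by
  cases j with
  | zero => exact Finset.disjoint_empty_left A
  | succ j => exact Finset.disjoint_sdiff

theorem card_explore_le {c₀ : ℕ} (hc : ∀ x e, (b.child x e).card ≤ c₀) (A : Finset S) (r : S → E)
    (j : ℕ) : ((b.explore A r j).1 ∪ (b.explore A r j).2).card ≤ (1 + c₀) ^ j * A.card := by
  induction j with
  | zero => simp [explore]
  | succ j ih =>
    set V := (b.explore A r j).1
    set B := (b.explore A r j).2
    calc ((b.explore A r (j + 1)).1 ∪ (b.explore A r (j + 1)).2).card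
        = ((V ∪ B) ∪ discovered b.child B r).card := by
          simp only [explore, Finset.union_sdiff_self_eq_union, V, B]
      _ ≤ (V ∪ B).card + B.card * c₀ := (Finset.card_union_le _ _).trans <| by
          gcongr
          exact Finset.card_biUnion_le_card_mul _ _ _ fun x _ => hc x _
      _ ≤ (V ∪ B).card + (V ∪ B).card * c₀ := by gcongr; exact Finset.subset_union_right
      _ = (V ∪ B).card * (1 + c₀) := by ring
      _ ≤ (1 + c₀) ^ j * A.card * (1 + c₀) := by gcongr
      _ = (1 + c₀) ^ (j + 1) * A.card := by ring

theorem reachable_explore {A : Finset S} {r : S → E} (j : ℕ) :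
    ∀ x ∈ (b.explore A r j).2, ∃ a ∈ A, Relation.ReflTransGen (b.Leads r) a x := by
  induction j with
  | zero => exact fun x hx => ⟨x, hx, .refl⟩
  | succ j ih =>
    intro x hx
    obtain ⟨y, hy, hxy⟩ := Finset.mem_biUnion.1 (Finset.mem_sdiff.1 hx).1
    obtain ⟨a, ha, hay⟩ := ih y hy
    exact ⟨a, ha, hay.tail (.inl hxy)⟩

variable {A : Finset S} {z : ℤ × ℤ} (hA : ∀ x ∈ A, b.layer x = z)
include hA

theorem layer_explore (r : S → E) (j : ℕ) :
    (∀ x ∈ (b.explore A r j).1, b.layer x = z) ∧ ∀ x ∈ (b.explore A r j).2, b.layer x = z := by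
  induction j with
  | zero => exact ⟨fun x hx => absurd hx (Finset.notMem_empty x), hA⟩
  | succ j ih =>
    refine ⟨fun x hx => (Finset.mem_union.1 hx).elim (ih.1 x) (ih.2 x), fun x hx => ?_⟩
    obtain ⟨y, hy, hxy⟩ := Finset.mem_biUnion.1 (Finset.mem_sdiff.1 hx).1
    rw [b.layer_child hxy, ih.2 y hy]

variable {r r' : S → E} (h : ∀ x, b.layer x = z → r x = r' x)
include h

theorem exits_congr (i : Fin 2) : b.exits i A r = b.exits i A r' := by
  have hexplore : b.explore A r b.gens = b.explore A r' b.gens :=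
    b.explore_congr (fun x hx => h x ((b.layer_explore hA r _).1 x hx)) _ le_rfl
  rw [exits, exits, discovered_congr fun x hx => h x ((b.layer_explore hA r _).2 x hx), hexplore]

theorem good_congr : b.Good A r ↔ b.Good A r' :=
  forall_congr' fun i => by rw [b.exits_congr hA h i]

end Explore

section MeasurableExplore

variable [Countable S]

theorem measurable_explore (A : Finset S) (j : ℕ) : Measurable fun r => b.explore A r j := by
  induction j with
  | zero => exact measurable_const
  | succ j ih =>
    refine measurable_of_countable_bind
      (F := fun c r => (c.1 ∪ c.2, discovered b.child c.2 r \ (c.1 ∪ c.2))) ih fun c => ?_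
    exact (Measurable.of_discrete (f := fun D => (c.1 ∪ c.2, D \ (c.1 ∪ c.2)))).comp
      (measurable_discovered b.measurable_child c.2)

theorem measurable_exits (i : Fin 2) (A : Finset S) : Measurable (b.exits i A) :=
  measurable_of_countable_bind (F := fun c r => discovered (b.exit i) c.2 r)
    (b.measurable_explore A _) fun c => measurable_discovered (b.measurable_exit i) c.2

theorem measurableSet_good (A : Finset S) : MeasurableSet {r | b.Good A r} := by
  simp only [Good, Set.ofPred_forall]
  exact .iInter fun i =>
    b.measurable_exits i A (MeasurableSet.of_discrete (s := {D : Finset S | b.quota ≤ D.card}))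

end MeasurableExplore

section Growth

variable [Countable S] (κ : Measure E) [IsProbabilityMeasure κ] {c₀ : ℕ}
  (hc : ∀ x e, (b.child x e).card ≤ c₀) {A : Finset S} {δ : ℝ≥0∞}
include hc

/-- The data of the current generation are independent of the exploration that led to it. -/
theorem measure_discovered_explore_le {j : ℕ} {X : S → E → Finset S} (hX : ∀ x, Measurable (X x))
    (p : Finset S → Finset S → Finset S → Prop)
    (hp : ∀ V B, (V ∪ B).card ≤ (1 + c₀) ^ j * A.card →
      infinitePi (fun _ : S => κ) {r | p V B (discovered X B r)} ≤ δ) :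
    infinitePi (fun _ : S => κ) {r | p (b.explore A r j).1 (b.explore A r j).2
      (discovered X (b.explore A r j).2 r)} ≤ δ := by
  have hbound := infinitePi_inter_adapted_le (fun _ : S => κ) (b.measurable_explore A j)
    (Q := Set.univ) .univ (Bad := fun c => {r | p c.1 c.2 (discovered X c.2 r)})
    (fun c => measurable_discovered hX c.2
      (MeasurableSet.of_discrete (s := {D : Finset S | p c.1 c.2 D})))
    (fun c => (c.2 : Set S)) δ ?_
  · simpa only [Set.univ_inter, Set.mem_ofPred_eq, measure_univ, mul_one] using hbound
  rintro c ⟨r, -, rfl⟩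
  have hexplore : ∀ x y : S → E, (∀ s ∈ ((b.explore A r j).2 : Set S)ᶜ, x s = y s) →
      b.explore A x j = b.explore A r j → b.explore A y j = b.explore A r j := fun x y hxy hx => by
    rw [← b.explore_congr (fun s hs => hxy s ?_) j le_rfl, hx]
    exact Finset.disjoint_left.1 (b.disjoint_explore A r j) (by rwa [hx] at hs)
  refine ⟨fun x y hxy => ?_, fun x y hxy => ?_,
    hp _ _ (b.card_explore_le hc A r j)⟩
  · simp only [Set.univ_inter, Set.mem_preimage, Set.mem_singleton_iff]
    exact propext ⟨hexplore x y hxy, hexplore y x fun s hs => (hxy s hs).symm⟩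
  · simp only [Set.mem_ofPred_eq, discovered_congr hxy]

variable {size : ℕ → ℕ} (hA : size 0 ≤ A.card)
  (hgrow : ∀ j < b.gens, ∀ V B : Finset S, size j ≤ B.card →
    (V ∪ B).card ≤ (1 + c₀) ^ b.gens * A.card → infinitePi (fun _ : S => κ)
      {r | (discovered b.child B r \ (V ∪ B)).card < size (j + 1)} ≤ δ)
include hA hgrow

theorem measure_explore_small_le :
    infinitePi (fun _ : S => κ) {r | (b.explore A r b.gens).2.card < size b.gens}
      ≤ b.gens * δ := by
  let Stops (j : ℕ) : Set (S → E) := {r | size j ≤ (b.explore A r j).2.card ∧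
    (b.explore A r (j + 1)).2.card < size (j + 1)}
  have hStops : ∀ j ∈ Finset.range b.gens, infinitePi (fun _ : S => κ) (Stops j) ≤ δ := by
    intro j hj
    rw [Finset.mem_range] at hj
    refine b.measure_discovered_explore_le κ hc b.measurable_child
      (fun V B D => size j ≤ B.card ∧ (D \ (V ∪ B)).card < size (j + 1)) fun V B hVB => ?_
    by_cases hB : size j ≤ B.card
    · simpa only [hB, true_and] using hgrow j hj V B hB (hVB.trans (by gcongr; omega))
    · simp [hB]
  have hsub : {r | (b.explore A r b.gens).2.card < size b.gens} ⊆
      ⋃ j ∈ Finset.range b.gens, Stops j := by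
    intro r hr
    by_contra hno
    simp only [Set.mem_iUnion, Finset.mem_range, not_exists, Stops, Set.mem_ofPred_eq, not_and,
      not_lt] at hno
    have hall : ∀ j ≤ b.gens, size j ≤ (b.explore A r j).2.card := fun j => by
      induction j with
      | zero => exact fun _ => hA
      | succ j ih => exact fun hj => hno j hj (ih (Nat.le_of_succ_le hj))
    exact (hall _ le_rfl).not_gt hr
  calc _ ≤ infinitePi (fun _ : S => κ) (⋃ j ∈ Finset.range b.gens, Stops j) := measure_mono hsub
    _ ≤ ∑ _j ∈ Finset.range b.gens, δ :=
        (measure_biUnion_finset_le _ _).trans (Finset.sum_le_sum hStops)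
    _ = b.gens * δ := by rw [Finset.sum_const, Finset.card_range, nsmul_eq_mul]

theorem measure_not_good_le
    (hexit : ∀ i, ∀ B : Finset S, size b.gens ≤ B.card → B.card ≤ (1 + c₀) ^ b.gens * A.card →
      infinitePi (fun _ : S => κ) {r | (discovered (b.exit i) B r).card < b.quota} ≤ δ) :
    infinitePi (fun _ : S => κ) {r | ¬ b.Good A r} ≤ (b.gens + 2) * δ := by
  let Small : Set (S → E) := {r | (b.explore A r b.gens).2.card < size b.gens}
  let Blocked (i : Fin 2) : Set (S → E) := {r | size b.gens ≤ (b.explore A r b.gens).2.card ∧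
    (b.exits i A r).card < b.quota}
  have hBlocked : ∀ i, infinitePi (fun _ : S => κ) (Blocked i) ≤ δ := by
    intro i
    refine b.measure_discovered_explore_le κ hc (b.measurable_exit i)
      (fun _ B D => size b.gens ≤ B.card ∧ D.card < b.quota) fun V B hVB => ?_
    by_cases hB : size b.gens ≤ B.card
    · simpa only [hB, true_and] using
        hexit i B hB ((Finset.card_le_card Finset.subset_union_right).trans hVB)
    · simp [hB]
  have hsub : {r | ¬ b.Good A r} ⊆ Small ∪ ⋃ i, Blocked i := by
    intro r hr
    obtain ⟨i, hi⟩ := not_forall.1 hr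
    rcases lt_or_ge (b.explore A r b.gens).2.card (size b.gens) with h | h
    · exact .inl h
    · exact .inr (Set.mem_iUnion.2 ⟨i, h, not_le.1 hi⟩)
  calc _ ≤ infinitePi (fun _ : S => κ) Small + ∑ i, infinitePi (fun _ : S => κ) (Blocked i) :=
        (measure_mono hsub).trans ((measure_union_le _ _).trans
          (by gcongr; exact measure_iUnion_fintype_le _ _))
    _ ≤ b.gens * δ + ∑ _i : Fin 2, δ := by
        gcongr with i
        · exact b.measure_explore_small_le κ hc hA hgrow
        · exact hBlocked i
    _ = (b.gens + 2) * δ := by simp [add_mul]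

end Growth

section Percolation

/-- The sites from which the layer `z`, with `z.1 + z.2 = n`, is explored; no site if the layer
is not reached. -/
noncomputable def entry (A₀ : Finset S) : ℕ → ℤ × ℤ → (S → E) → Finset S
  | 0, z, _ => if z = 0 then A₀ else ∅
  | n + 1, z, r =>
    pick b.quota (Finset.univ.biUnion fun i => b.exits i (entry A₀ n (z - unitVec i) r) r)

/-- The layers that are reached. -/
def reached (A₀ : Finset S) (r : S → E) : Set (ℤ × ℤ) :=
  {z | (b.entry A₀ (z.1 + z.2).toNat z r).Nonempty}

/-- The layer `z` is reached, but its exploration fails. -/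
def Fails (A₀ : Finset S) (z : ℤ × ℤ) (r : S → E) : Prop :=
  z ∈ b.reached A₀ r ∧ ¬ b.Good (b.entry A₀ (z.1 + z.2).toNat z r) r

variable {A₀ : Finset S} {r r' : S → E} {n : ℕ} {z : ℤ × ℤ}

theorem exits_empty (i : Fin 2) (r : S → E) : b.exits i ∅ r = ∅ := by
  have h : ∀ j, (b.explore ∅ r j).2 = ∅ := fun j => by
    induction j with
    | zero => rfl
    | succ j ih => simp [explore, ih, discovered]
  simp [exits, h, discovered]

variable {b}

theorem exists_mem_exits {x : S} (hx : x ∈ b.entry A₀ (n + 1) z r) :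
    ∃ i, x ∈ b.exits i (b.entry A₀ n (z - unitVec i) r) r := by
  simpa using pick_subset _ _ hx

theorem exists_entry_nonempty (h : (b.entry A₀ (n + 1) z r).Nonempty) :
    ∃ i, (b.entry A₀ n (z - unitVec i) r).Nonempty := by
  obtain ⟨x, hx⟩ := h
  obtain ⟨i, hi⟩ := exists_mem_exits hx
  refine ⟨i, Finset.nonempty_iff_ne_empty.2 fun hempty => ?_⟩
  simp [hempty, exits_empty] at hi

theorem card_entry (hA₀ : A₀.card = b.quota) (h : (b.entry A₀ n z r).Nonempty) :
    (b.entry A₀ n z r).card = b.quota := by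
  cases n with
  | zero =>
    rw [entry] at h ⊢
    split_ifs at h ⊢ with hz
    · exact hA₀
    · exact absurd h Finset.not_nonempty_empty
  | succ n => exact card_pick_of_nonempty h

theorem fst_add_snd_sub_unitVec (z : ℤ × ℤ) (i : Fin 2) :
    (z - unitVec i).1 + (z - unitVec i).2 = z.1 + z.2 - 1 := by
  fin_cases i <;> simp [unitVec] <;> ring

theorem nonneg_of_entry (h : (b.entry A₀ n z r).Nonempty) : 0 ≤ z ∧ z.1 + z.2 = n := by
  induction n generalizing z with
  | zero =>
    rw [entry] at h
    split_ifs at h with hz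
    · simp [hz]
    · exact absurd h Finset.not_nonempty_empty
  | succ n ih =>
    obtain ⟨i, hi⟩ := exists_entry_nonempty h
    obtain ⟨hnonneg, hsum⟩ := ih hi
    refine ⟨hnonneg.trans (sub_le_self z ?_), ?_⟩
    · fin_cases i <;> simp [unitVec, Prod.le_def]
    · rw [fst_add_snd_sub_unitVec] at hsum
      push_cast
      omega

theorem mem_reached_of_entry (h : (b.entry A₀ n z r).Nonempty) : z ∈ b.reached A₀ r := by
  have hn : (z.1 + z.2).toNat = n := by rw [(nonneg_of_entry h).2, Int.toNat_natCast]
  rwa [reached, Set.mem_ofPred_eq, hn]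

theorem reached_pred (hz : z ∈ b.reached A₀ r) (h0 : z ≠ 0) :
    ∃ i, z - unitVec i ∈ b.reached A₀ r := by
  rw [reached, Set.mem_ofPred_eq] at hz
  cases hn : (z.1 + z.2).toNat with
  | zero => simp [hn, entry, h0] at hz
  | succ n =>
    rw [hn] at hz
    obtain ⟨i, hi⟩ := exists_entry_nonempty hz
    exact ⟨i, mem_reached_of_entry hi⟩

theorem fails_of_reached (hquota : 0 < b.quota) (hz : z ∈ b.reached A₀ r) {i : Fin 2}
    (h : z + unitVec i ∉ b.reached A₀ r) : b.Fails A₀ z r := by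
  refine ⟨hz, fun hgood => h (mem_reached_of_entry (n := (z.1 + z.2).toNat + 1) ?_)⟩
  refine pick_nonempty hquota (((hgood i).trans_eq ?_).trans
    (Finset.card_le_card (Finset.subset_biUnion_of_mem _ (Finset.mem_univ i))))
  rw [add_sub_cancel_right]

theorem reachable_entry : ∀ x ∈ b.entry A₀ n z r,
    ∃ a ∈ A₀, Relation.ReflTransGen (b.Leads r) a x := by
  induction n generalizing z with
  | zero =>
    rw [entry]
    split_ifs
    · exact fun x hx => ⟨x, hx, .refl⟩
    · simp
  | succ n ih =>
    intro x hx
    obtain ⟨i, hi⟩ := exists_mem_exits hx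
    obtain ⟨y, hy, hxy⟩ := Finset.mem_biUnion.1 hi
    obtain ⟨u, hu, huy⟩ := b.reachable_explore _ y hy
    obtain ⟨a, ha, hau⟩ := ih u hu
    exact ⟨a, ha, (hau.trans huy).tail (.inr ⟨i, hxy⟩)⟩

section Layer

variable (hA₀ : ∀ x ∈ A₀, b.layer x = 0)
include hA₀

theorem layer_entry : ∀ x ∈ b.entry A₀ n z r, b.layer x = z := by
  induction n generalizing z with
  | zero =>
    rw [entry]
    split_ifs with hz
    · rwa [hz]
    · simp
  | succ n ih =>
    intro x hx
    obtain ⟨i, hi⟩ := exists_mem_exits hx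
    obtain ⟨y, hy, hxy⟩ := Finset.mem_biUnion.1 hi
    rw [b.layer_exit hxy, (b.layer_explore ih r _).2 y hy, sub_add_cancel]

theorem entry_congr (h : ∀ x, (b.layer x).1 + (b.layer x).2 < n → r x = r' x) :
    b.entry A₀ n z r = b.entry A₀ n z r' := by
  induction n generalizing z with
  | zero => rfl
  | succ n ih =>
    rw [entry, entry]
    congr 2
    funext i
    rw [← ih fun x hx => h x (by push_cast; omega)]
    rcases Finset.eq_empty_or_nonempty (b.entry A₀ n (z - unitVec i) r) with hempty | hne
    · rw [hempty, exits_empty, exits_empty]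
    · refine b.exits_congr (layer_entry hA₀) (fun x hx => h x ?_) i
      rw [hx, (nonneg_of_entry hne).2]
      push_cast
      omega

theorem fails_congr
    (h : ∀ x, (b.layer x).1 + (b.layer x).2 < (z.1 + z.2).toNat ∨ b.layer x = z → r x = r' x) :
    b.Fails A₀ z r ↔ b.Fails A₀ z r' := by
  rw [Fails, Fails, reached, reached, Set.mem_ofPred_eq, Set.mem_ofPred_eq,
    entry_congr hA₀ fun x hx => h x (.inl hx),
    b.good_congr (layer_entry hA₀) fun x hx => h x (.inr hx)]

end Layer

section Measure

variable [Countable S]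

theorem measurable_entry (n : ℕ) (z : ℤ × ℤ) : Measurable (b.entry A₀ n z) := by
  induction n generalizing z with
  | zero => exact measurable_const
  | succ n ih =>
    exact (Measurable.of_discrete (f := pick b.quota)).comp (measurable_biUnion _ fun i =>
      measurable_of_countable_bind (F := b.exits i) (ih _) (b.measurable_exits i))

theorem measurableSet_fails (z : ℤ × ℤ) : MeasurableSet {r | b.Fails A₀ z r} :=
  measurableSet_setOfPred.2 <| measurable_of_countable_bind
    (F := fun A r => A.Nonempty ∧ ¬ b.Good A r) (measurable_entry _ z) fun A =>
      measurable_const.and (measurableSet_setOfPred.1 (b.measurableSet_good A)).not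

variable (κ : Measure E) [IsProbabilityMeasure κ] (hlayer : ∀ x ∈ A₀, b.layer x = 0)
  (hcard : A₀.card = b.quota) {ε : ℝ≥0∞}
  (hε : ∀ A : Finset S, A.card = b.quota → infinitePi (fun _ : S => κ) {r | ¬ b.Good A r} ≤ ε)
include hlayer hcard hε

/-- The exploration of a new layer uses fresh data. -/
theorem measure_fails_inter_le {T : Finset (ℤ × ℤ)} (hz : z ∉ T)
    (hmax : ∀ w ∈ T, w.1 + w.2 ≤ z.1 + z.2) :
    infinitePi (fun _ : S => κ) ({r | ∀ w ∈ T, b.Fails A₀ w r} ∩ {r | b.Fails A₀ z r})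
      ≤ ε * infinitePi (fun _ : S => κ) {r | ∀ w ∈ T, b.Fails A₀ w r} := by
  rcases lt_or_ge (z.1 + z.2) 0 with hneg | hnonneg
  · have hempty : {r : S → E | b.Fails A₀ z r} = ∅ := by
      refine Set.eq_empty_of_forall_notMem fun r hr => ?_
      have := (nonneg_of_entry hr.1).2
      omega
    simp [hempty]
  have mQ : MeasurableSet {r : S → E | ∀ w ∈ T, b.Fails A₀ w r} := by
    simp only [Set.ofPred_forall]
    exact .biInter T.countable_toSet fun w _ => measurableSet_fails w
  refine infinitePi_inter_adapted_le (fun _ : S => κ) (measurable_entry (z.1 + z.2).toNat z) mQ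
    (Bad := fun A => {r | A.Nonempty ∧ ¬ b.Good A r})
    (fun A => (MeasurableSet.const A.Nonempty).inter (b.measurableSet_good A).compl)
    (fun _ => {x | b.layer x = z}) ε ?_
  rintro A ⟨r, -, rfl⟩
  refine ⟨fun x y hxy => ?_, fun x y hxy => ?_, ?_⟩
  · have hfails : ∀ w ∈ T, b.Fails A₀ w x ↔ b.Fails A₀ w y := fun w hw =>
      fails_congr hlayer fun u hu => hxy u <| by
        rintro rfl
        have := hmax w hw
        rcases hu with hu | rfl
        · omega
        · exact hz hw
    have hentry : b.entry A₀ (z.1 + z.2).toNat z x = b.entry A₀ (z.1 + z.2).toNat z y :=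
      entry_congr hlayer fun u hu => hxy u <| by
        rintro rfl
        omega
    simp only [Set.mem_inter_iff, Set.mem_ofPred_eq, Set.mem_preimage, hentry]
    exact propext (and_congr_left fun _ => forall₂_congr hfails)
  · simp only [Set.mem_ofPred_eq, b.good_congr (layer_entry hlayer) hxy]
  · by_cases hne : (b.entry A₀ (z.1 + z.2).toNat z r).Nonempty
    · simpa only [hne, true_and] using hε _ (card_entry hcard hne)
    · simp [hne]

theorem measure_forall_fails_le (T : Finset (ℤ × ℤ)) :
    infinitePi (fun _ : S => κ) {r | ∀ z ∈ T, b.Fails A₀ z r} ≤ ε ^ T.card := by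
  induction T using Finset.induction_on_max_value (fun z : ℤ × ℤ => z.1 + z.2) with
  | empty => simp
  | insert z T hz hmax ih =>
    have hset : {r : S → E | ∀ w ∈ insert z T, b.Fails A₀ w r} =
        {r | ∀ w ∈ T, b.Fails A₀ w r} ∩ {r | b.Fails A₀ z r} := by
      ext r
      simp [and_comm]
    rw [hset, Finset.card_insert_of_notMem hz, pow_succ']
    exact (measure_fails_inter_le κ hlayer hcard hε hz hmax).trans (by gcongr)

end Measure

end Percolation

end LayeredRule

theorem tsum_mul_geometric_lt_one : ∑' n : ℕ, (n : ℝ≥0∞) * (1 / 8) ^ n < 1 := by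
  have hreal : HasSum (fun n : ℕ => (n : ℝ) * (1 / 8) ^ n) (1 / 8 / (1 - 1 / 8) ^ 2) :=
    hasSum_coe_mul_geometric_of_norm_lt_one (by norm_num)
  have hterm : ∀ n : ℕ, (n : ℝ≥0∞) * (1 / 8) ^ n = ENNReal.ofReal (n * (1 / 8) ^ n) := fun n => by
    rw [ENNReal.ofReal_mul n.cast_nonneg, ENNReal.ofReal_natCast,
      ENNReal.ofReal_pow (by norm_num), ENNReal.ofReal_div_of_pos (by norm_num),
      ENNReal.ofReal_one, ENNReal.ofReal_ofNat]
  rw [tsum_congr hterm, ← ENNReal.ofReal_tsum_of_nonneg (fun n => by positivity) hreal.summable,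
    hreal.tsum_eq, ENNReal.ofReal_lt_one]
  norm_num

namespace LayeredRule

variable {S E : Type*} [DecidableEq S] [MeasurableSpace E] {b : LayeredRule S E} {A₀ : Finset S}
  {r : S → E}

theorem exists_contourExits_fails (hA₀ : A₀.Nonempty) (hquota : 0 < b.quota)
    (hfin : (b.reached A₀ r).Finite) :
    ∃ n, ∃ (k : Fin n) (w : Fin n → Direction), n ≤ 4 * (contourExits k w).card ∧
      ∀ z ∈ contourExits k w, b.Fails A₀ z r := by
  have h0 : (0 : ℤ × ℤ) ∈ b.reached A₀ r := mem_reached_of_entry (n := 0) (by simpa [entry])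
  obtain ⟨n, k, hk, w, hw, hexit⟩ := exists_contourExits hfin h0
    (fun z hz => (nonneg_of_entry hz).1)
    fun z hz hz0 => Fin.exists_fin_two.1 (reached_pred hz hz0)
  refine ⟨n, ⟨k, hk⟩, w, hw, fun z hz => ?_⟩
  obtain ⟨hzW, h | h⟩ := hexit z hz
  · exact fails_of_reached (i := 0) hquota hzW h
  · exact fails_of_reached (i := 1) hquota hzW h

variable [Countable S] (κ : Measure E) [IsProbabilityMeasure κ]
  (hlayer : ∀ x ∈ A₀, b.layer x = 0) (hcard : A₀.card = b.quota) (hquota : 0 < b.quota)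
  (hgood : ∀ A : Finset S, A.card = b.quota →
    infinitePi (fun _ : S => κ) {r | ¬ b.Good A r} ≤ (1 / 32) ^ 4)
include hlayer hcard hquota hgood

/-- Each of the at most `n * 4 ^ n` contours of length `n` has at least `n / 4` exits, all of
which fail with probability at most `(1 / 32) ^ n`. -/
theorem measure_finite_reached_lt_one :
    infinitePi (fun _ : S => κ) {r | (b.reached A₀ r).Finite} < 1 := by
  set μ := infinitePi fun _ : S => κ
  let Blocking (n : ℕ) (k : Fin n) (w : Fin n → Direction) : Set (S → E) :=
    {r | n ≤ 4 * (contourExits k w).card ∧ ∀ z ∈ contourExits k w, b.Fails A₀ z r}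
  have hBlocking : ∀ n k w, μ (Blocking n k w) ≤ (1 / 32) ^ n := fun n k w => by
    by_cases hn : n ≤ 4 * (contourExits k w).card
    · calc μ (Blocking n k w) ≤ μ {r | ∀ z ∈ contourExits k w, b.Fails A₀ z r} :=
            measure_mono fun r hr => hr.2
        _ ≤ ((1 / 32) ^ 4) ^ (contourExits k w).card :=
            measure_forall_fails_le κ hlayer hcard hgood _
        _ = (1 / 32) ^ (4 * (contourExits k w).card) := (pow_mul _ _ _).symm
        _ ≤ (1 / 32) ^ n :=
            pow_le_pow_right_of_le_one' (by simp [ENNReal.inv_le_one]) hn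
    · simp [Blocking, hn]
  have hcardDirection : Fintype.card Direction = 4 := rfl
  have hlength : ∀ n, μ (⋃ k, ⋃ w, Blocking n k w) ≤ n * (1 / 8) ^ n := fun n => by
    calc μ (⋃ k, ⋃ w, Blocking n k w) ≤ ∑ k, ∑ w, μ (Blocking n k w) :=
          (measure_iUnion_fintype_le _ _).trans
            (Finset.sum_le_sum fun k _ => measure_iUnion_fintype_le _ _)
      _ ≤ ∑ _k : Fin n, ∑ _w : Fin n → Direction, (1 / 32) ^ n := by
          gcongr with k _ w
          exact hBlocking n k w
      _ = n * (4 * (1 / 32)) ^ n := by simp [hcardDirection, mul_pow]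
      _ = n * (1 / 8) ^ n := by
          congr 2
          rw [← ENNReal.toReal_eq_toReal_iff' (by finiteness) (by finiteness)]
          norm_num
  have hsub : {r | (b.reached A₀ r).Finite} ⊆ ⋃ n, ⋃ k, ⋃ w, Blocking n k w := fun r hr => by
    simp only [Set.mem_iUnion]
    exact exists_contourExits_fails (Finset.card_pos.1 (hcard ▸ hquota)) hquota hr
  calc μ {r | (b.reached A₀ r).Finite} ≤ ∑' n, μ (⋃ k, ⋃ w, Blocking n k w) :=
        (measure_mono hsub).trans (measure_iUnion_le _)
    _ ≤ ∑' n : ℕ, (n : ℝ≥0∞) * (1 / 8) ^ n := ENNReal.tsum_le_tsum hlength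
    _ < 1 := tsum_mul_geometric_lt_one

theorem exists_pos_infinite_reachable :
    ∃ a ∈ A₀, 0 < infinitePi (fun _ : S => κ)
      {r | {y | Relation.ReflTransGen (b.Leads r) a y}.Infinite} := by
  set μ := infinitePi fun _ : S => κ
  by_contra! hcon
  have hsub : Set.univ ⊆ {r | (b.reached A₀ r).Finite} ∪
      ⋃ a ∈ A₀, {r | {y | Relation.ReflTransGen (b.Leads r) a y}.Infinite} := by
    rintro r -
    by_contra hno
    simp only [Set.mem_union, Set.mem_iUnion, Set.mem_ofPred_eq, not_or, not_exists,
      Set.not_infinite] at hno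
    refine hno.1 (((Set.Finite.biUnion A₀.finite_toSet hno.2).image b.layer).subset ?_)
    rintro z ⟨x, hx⟩
    obtain ⟨a, ha, hax⟩ := reachable_entry x hx
    exact ⟨x, Set.mem_biUnion ha hax, layer_entry hlayer x hx⟩
  have hzero : μ (⋃ a ∈ A₀, {r | {y | Relation.ReflTransGen (b.Leads r) a y}.Infinite}) = 0 :=
    (measure_biUnion_null_iff A₀.countable_toSet).2 fun a ha => le_zero_iff.1 (hcon a ha)
  have hle : (1 : ℝ≥0∞) ≤ μ {r | (b.reached A₀ r).Finite} := by
    calc (1 : ℝ≥0∞) = μ Set.univ := measure_univ.symm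
      _ ≤ _ := (measure_mono hsub).trans (measure_union_le _ _)
      _ = μ {r | (b.reached A₀ r).Finite} := by rw [hzero, add_zero]
  exact hle.not_gt (measure_finite_reached_lt_one κ hlayer hcard hquota hgood)

end LayeredRule

section ActivationTime

variable {d : ℕ} {ω : Config d} {x y : Site d}

theorem passageTime_le {i n : ℕ} (hi : i < count ω x) (hn : (n : ℕ∞) < lifetime ω x i)
    (hy : walk ω x i n = y) : passageTime ω x y ≤ n :=
  iInf₂_le_of_le i hi (iInf₂_le_of_le n ⟨hn, hy⟩ le_rfl)

theorem exists_of_passageTime_lt_top (h : passageTime ω x y < ⊤) :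
    ∃ i n : ℕ, i < count ω x ∧ (n : ℕ∞) < lifetime ω x i ∧ walk ω x i n = y ∧
      passageTime ω x y = n := by
  have hlt : passageTime ω x y < passageTime ω x y + 1 := (ENat.lt_add_one_iff h.ne).2 le_rfl
  conv_lhs at hlt => unfold passageTime
  simp only [iInf_lt_iff] at hlt
  obtain ⟨i, hi, n, hn, hlt⟩ := hlt
  exact ⟨i, n, hi, hn.1, hn.2, le_antisymm (passageTime_le hi hn.1 hn.2)
    ((ENat.lt_add_one_iff h.ne).1 hlt)⟩

theorem one_le_passageTime (hxy : x ≠ y) : 1 ≤ passageTime ω x y := by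
  by_cases h : passageTime ω x y < ⊤
  · obtain ⟨i, n, -, -, hn, hpassage⟩ := exists_of_passageTime_lt_top h
    have hn0 : n ≠ 0 := fun h0 => hxy (by simpa [walk, h0] using hn)
    rw [hpassage]
    exact_mod_cast Nat.one_le_iff_ne_zero.2 hn0
  · rw [not_lt_top_iff.1 h]
    exact le_top

theorem finite_passageTime_le (x : Site d) (N : ℕ) : {y | passageTime ω x y ≤ N}.Finite := by
  refine ((Set.finite_Iio (count ω x)).biUnion fun i _ =>
    (Set.finite_Iic N).image (walk ω x i)).subset fun y hy => ?_
  have hy : passageTime ω x y ≤ N := hy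
  obtain ⟨i, n, hi, -, hn, hpassage⟩ :=
    exists_of_passageTime_lt_top (hy.trans_lt (ENat.natCast_lt_top N))
  exact Set.mem_biUnion hi ⟨n, by rw [hpassage] at hy; exact_mod_cast hy, hn⟩

theorem activationTime_le (s : ℕ → Site d) (h0 : s 0 = 0) (m : ℕ) :
    activationTime ω (s m) ≤ ∑ j ∈ Finset.range m, passageTime ω (s j) (s (j + 1)) :=
  iInf₂_le_of_le m s (iInf_le_of_le ⟨h0, rfl⟩ le_rfl)

theorem activationTime_zero : activationTime ω 0 = 0 :=
  le_antisymm (by simpa using activationTime_le (ω := ω) (fun _ => 0) rfl 0) zero_le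

theorem exists_of_activationTime_lt_top (h : activationTime ω x < ⊤) :
    ∃ (m : ℕ) (s : ℕ → Site d), s 0 = 0 ∧ s m = x ∧
      ∑ j ∈ Finset.range m, passageTime ω (s j) (s (j + 1)) ≤ activationTime ω x := by
  have hlt : activationTime ω x < activationTime ω x + 1 := (ENat.lt_add_one_iff h.ne).2 le_rfl
  conv_lhs at hlt => unfold activationTime
  simp only [iInf_lt_iff] at hlt
  obtain ⟨m, s, hs, hlt⟩ := hlt
  exact ⟨m, s, hs.1, hs.2, (ENat.lt_add_one_iff h.ne).1 hlt⟩

theorem activationTime_le_add : activationTime ω y ≤ activationTime ω x + passageTime ω x y := by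
  by_cases hx : activationTime ω x < ⊤
  swap
  · rw [not_lt_top_iff.1 hx]
    simp
  obtain ⟨m, s, h0, hm, hs⟩ := exists_of_activationTime_lt_top hx
  let s' := Function.update s (m + 1) y
  have hs' : ∀ j ≤ m, s' j = s j := fun j hj => Function.update_of_ne (by omega) _ _
  have hlast : s' (m + 1) = y := Function.update_self ..
  calc activationTime ω y
      ≤ ∑ j ∈ Finset.range (m + 1), passageTime ω (s' j) (s' (j + 1)) :=
        hlast ▸ activationTime_le s' ((hs' 0 m.zero_le).trans h0) (m + 1)
    _ = ∑ j ∈ Finset.range m, passageTime ω (s j) (s (j + 1)) + passageTime ω x y := by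
        rw [Finset.sum_range_succ, hs' m le_rfl, hm, hlast]
        congr 1
        refine Finset.sum_congr rfl fun j hj => ?_
        rw [Finset.mem_range] at hj
        rw [hs' j hj.le, hs' (j + 1) hj]
    _ ≤ activationTime ω x + passageTime ω x y := by gcongr

theorem exists_pred (hx : x ≠ 0) (h : activationTime ω x < ⊤) :
    ∃ x', activationTime ω x' < activationTime ω x ∧
      activationTime ω x' + passageTime ω x' x ≤ activationTime ω x := by
  obtain ⟨m, s, h0, hm, hs⟩ := exists_of_activationTime_lt_top h
  have hpred : ∀ m, s m = x → ∃ x' ≠ x, activationTime ω x' + passageTime ω x' x ≤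
      ∑ j ∈ Finset.range m, passageTime ω (s j) (s (j + 1)) := fun m => by
    induction m with
    | zero => exact fun hm => absurd (hm.symm.trans h0) hx
    | succ m ih =>
      intro hm
      rw [Finset.sum_range_succ]
      by_cases hsm : s m = x
      · obtain ⟨x', hx', hle⟩ := ih hsm
        exact ⟨x', hx', hle.trans le_self_add⟩
      · refine ⟨s m, hsm, ?_⟩
        rw [hm]
        gcongr
        exact activationTime_le s h0 m
  obtain ⟨x', hx', hle⟩ := hpred m hm
  have hle := hle.trans hs
  have hfin : activationTime ω x' ≠ ⊤ := ((le_self_add.trans hle).trans_lt h).ne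
  refine ⟨x', ((ENat.lt_add_one_iff hfin).2 le_rfl).trans_le (le_trans ?_ hle), hle⟩
  gcongr
  exact one_le_passageTime hx'

theorem reachable_iff_activationTime_lt_top :
    Relation.ReflTransGen (fun x y => passageTime ω x y < ⊤) 0 y ↔ activationTime ω y < ⊤ := by
  constructor
  · intro h
    induction h with
    | refl => simp [activationTime_zero]
    | tail _ hxy ih => exact activationTime_le_add.trans_lt (ENat.add_lt_top.2 ⟨ih, hxy⟩)
  · induction y using WellFounded.induction (InvImage.wf (activationTime ω) wellFounded_lt) with
    | _ y ih =>
      intro h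
      by_cases hy : y = 0
      · rw [hy]
      obtain ⟨x, hxy, hle⟩ := exists_pred hy h
      exact (ih x hxy (hxy.trans h)).tail ((le_add_self.trans hle).trans_lt h)

theorem finite_activationTime_le (N : ℕ) : {x | activationTime ω x ≤ N}.Finite := by
  have hsub : ∀ N : ℕ, {x | activationTime ω x ≤ N} ⊆
      {0} ∪ ⋃ x' ∈ {x' | activationTime ω x' < N}, {x | passageTime ω x' x ≤ N} := by
    intro N x hx
    have hx : activationTime ω x ≤ N := hx
    by_cases h0 : x = 0
    · exact .inl h0
    obtain ⟨x', hlt, hle⟩ := exists_pred h0 (hx.trans_lt (ENat.natCast_lt_top N))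
    exact .inr (Set.mem_biUnion (hlt.trans_le hx) ((le_add_self.trans hle).trans hx))
  induction N with
  | zero => exact (Set.finite_singleton 0).subset ((hsub 0).trans (by simp))
  | succ N ih =>
    refine ((Set.finite_singleton 0).union (.biUnion (ih.subset fun x hx => ?_) fun x' _ =>
      finite_passageTime_le x' (N + 1))).subset (hsub (N + 1))
    have hx : activationTime ω x < ((N + 1 : ℕ) : ℕ∞) := hx
    push_cast at hx
    exact Order.le_of_lt_add_one hx

/-- The activator of the first site to be activated after time `N` is active at time `N`. -/
theorem survives_of_infinite (h : {x | activationTime ω x < ⊤}.Infinite) : Survives ω := by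
  intro N
  have hne : {x | activationTime ω x < ⊤ ∧ (N : ℕ∞) < activationTime ω x}.Nonempty := by
    obtain ⟨x, hx, hx'⟩ := (h.sdiff (finite_activationTime_le (ω := ω) N)).nonempty
    exact ⟨x, hx, not_le.1 hx'⟩
  obtain ⟨x, ⟨hx, hN⟩, hmin⟩ :=
    (InvImage.wf (activationTime ω) wellFounded_lt).has_min _ hne
  have hx0 : x ≠ 0 := by
    rintro rfl
    rw [activationTime_zero] at hN
    exact not_lt_zero hN
  obtain ⟨x', hlt, hle⟩ := exists_pred hx0 hx
  obtain ⟨i, n, hi, hn, -, hpassage⟩ :=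
    exists_of_passageTime_lt_top ((le_add_self.trans hle).trans_lt hx)
  refine ⟨x', i, hi, not_lt.1 fun hcon => hmin x' ⟨hlt.trans hx, hcon⟩ hlt, ?_⟩
  calc (N : ℕ∞) < activationTime ω x := hN
    _ ≤ activationTime ω x' + passageTime ω x' x := activationTime_le_add
    _ ≤ activationTime ω x' + lifetime ω x' i := by rw [hpassage]; gcongr

theorem infinite_of_survives (hlife : ∀ x i, lifetime ω x i < ⊤) (h : Survives ω) :
    {x | activationTime ω x < ⊤}.Infinite := by
  intro hfin
  let deaths : Set ℕ∞ := ⋃ x ∈ {x | activationTime ω x < ⊤},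
    (fun i => activationTime ω x + lifetime ω x i) '' Set.Iio (count ω x)
  have hdeaths : deaths.Finite := hfin.biUnion fun x _ => (Set.finite_Iio _).image _
  obtain ⟨N, hN⟩ : ∃ N : ℕ, ∀ t ∈ deaths, t ≤ N := by
    obtain ⟨N, hN⟩ := (hdeaths.image ENat.toNat).bddAbove
    refine ⟨N, fun t ht => ?_⟩
    have htop : t ≠ ⊤ := by
      simp only [deaths, Set.mem_iUnion] at ht
      obtain ⟨x, hx, i, -, rfl⟩ := ht
      exact (ENat.add_lt_top.2 ⟨hx, hlife x i⟩).ne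
    rw [← ENat.natCast_toNat htop]
    exact_mod_cast hN ⟨t, ht, rfl⟩
  obtain ⟨x, i, hi, hactive, halive⟩ := h N
  exact (hN _ (Set.mem_biUnion (hactive.trans_lt (ENat.natCast_lt_top N))
    ⟨i, hi, rfl⟩)).not_gt halive

end ActivationTime

section SiteData

variable {d : ℕ}

/-- The randomness attached to one site: the number of particles, the steps of the `i`-th particle
and the lifetime of the `i`-th particle. -/
abbrev SiteData (d : ℕ) : Type := ℕ × (ℕ → ℕ → Site d) × (ℕ → ℕ∞)

/-- The law of the randomness attached to one site in the frog model. -/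
noncomputable def siteLaw (d : ℕ) (p : unitInterval) (ν : Measure ℕ) [IsProbabilityMeasure ν] :
    Measure (SiteData d) :=
  ν.prod ((infinitePi fun _ : ℕ => infinitePi fun _ : ℕ => stepLaw d).prod
    (infinitePi fun _ : ℕ => lifetimeLaw p))

instance (d : ℕ) (p : unitInterval) (ν : Measure ℕ) [IsProbabilityMeasure ν] :
    IsProbabilityMeasure (siteLaw d p ν) := by
  unfold siteLaw; infer_instance

/-- A realization of the frog model, viewed as a field of data indexed by the sites. -/
def toField (ω : Config d) : Site d → SiteData d :=
  fun x => (ω.1 x, fun i => ω.2.1 (x, i), fun i => ω.2.2 (x, i))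

theorem measurePreserving_toField (d : ℕ) (p : unitInterval) (ν : Measure ℕ)
    [IsProbabilityMeasure ν] :
    MeasurePreserving toField (frogLaw d p ν) (infinitePi fun _ : Site d => siteLaw d p ν) := by
  have hsteps : MeasurePreserving (MeasurableEquiv.curry (Site d) ℕ (ℕ → Site d)) _ _ :=
    ⟨by fun_prop, infinitePi_map_curry fun _ _ => infinitePi fun _ : ℕ => stepLaw d⟩
  have hlives : MeasurePreserving (MeasurableEquiv.curry (Site d) ℕ ℕ∞) _ _ :=
    ⟨by fun_prop, infinitePi_map_curry fun _ _ => lifetimeLaw p⟩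
  have hzip {X Y : Type} [MeasurableSpace X] [MeasurableSpace Y] (P : Measure X) (Q : Measure Y)
      [IsProbabilityMeasure P] [IsProbabilityMeasure Q] :
      MeasurePreserving (fun (f : (Site d → X) × (Site d → Y)) x => (f.1 x, f.2 x)) _ _ :=
    ⟨by fun_prop, infinitePi_map_zip (fun _ => P) fun _ => Q⟩
  exact (hzip _ _).comp ((MeasurePreserving.id (infinitePi fun _ : Site d => ν)).prod
    ((hzip _ _).comp (hsteps.prod hlives)))

/-- The displacement after `n` steps of the `i`-th particle. -/
def displ (e : SiteData d) (i n : ℕ) : Site d := ∑ k ∈ Finset.range n, e.2.1 i k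

@[fun_prop]
theorem measurable_displ (i n : ℕ) : Measurable fun e : SiteData d => displ e i n := by
  unfold displ; fun_prop

/-- The `i`-th particle exists, lives for more than `n` steps, and takes its first `n` steps
in `Z`. -/
def Runs (Z : Set (Site d)) (e : SiteData d) (i n : ℕ) : Prop :=
  i < e.1 ∧ (n : ℕ∞) < e.2.2 i ∧ ∀ k < n, e.2.1 i k ∈ Z

theorem runs_eq_prod (Z : Set (Site d)) (i n : ℕ) : {e : SiteData d | Runs Z e i n} =
    {m | i < m} ×ˢ ({f | ∀ k < n, f i k ∈ Z} ×ˢ {l | (n : ℕ∞) < l i}) := by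
  ext e; simp [Runs]; tauto

theorem measurableSet_runs (Z : Set (Site d)) (i n : ℕ) :
    MeasurableSet {e : SiteData d | Runs Z e i n} := by
  have hstep (k : ℕ) : Measurable fun f : ℕ → ℕ → Site d => f i k := by fun_prop
  have hlife : Measurable fun l : ℕ → ℕ∞ => l i := by fun_prop
  rw [runs_eq_prod]
  refine .prod .of_discrete (.prod ?_ (hlife (.of_discrete (s := {t | (n : ℕ∞) < t}))))
  simp only [Set.ofPred_forall]
  exact .iInter fun k => .iInter fun _ => hstep k (.of_discrete (s := Z))

/-- Some particle starting from `x`, where the data are `e`, is at `y` at some time while alive. -/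
def Visits (e : SiteData d) (x y : Site d) : Prop :=
  ∃ i n, Runs Set.univ e i n ∧ x + displ e i n = y

theorem measurableSet_visits (x y : Site d) : MeasurableSet {e : SiteData d | Visits e x y} := by
  simp only [Visits, Set.ofPred_exists]
  refine .iUnion fun i => .iUnion fun n => (measurableSet_runs _ i n).inter ?_
  have h : Measurable fun e : SiteData d => x + displ e i n := by fun_prop
  exact h (.singleton y)

theorem visits_toField_iff {ω : Config d} {x y : Site d} :
    Visits (toField ω x) x y ↔ passageTime ω x y < ⊤ := by
  constructor
  · rintro ⟨i, n, ⟨hi, hn, -⟩, hy⟩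
    exact (passageTime_le hi hn hy).trans_lt (ENat.natCast_lt_top n)
  · intro h
    obtain ⟨i, n, hi, hn, hy, -⟩ := exists_of_passageTime_lt_top h
    exact ⟨i, n, ⟨hi, hn, fun _ _ => trivial⟩, hy⟩

end SiteData

section Lifetime

variable (p : unitInterval)

theorem lifetimeLaw_lt (n : ℕ) : lifetimeLaw p {t | (n : ℕ∞) < t} = ENNReal.ofReal (p ^ n) := by
  unfold lifetimeLaw
  split_ifs with h
  · subst h
    simp
  have hq : unitInterval.symm p ≠ 0 := fun h' => h (by simpa using congrArg unitInterval.symm h')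
  have hset : (fun n : ℕ => ((n + 1 : ℕ) : ℕ∞)) ⁻¹' {t | (n : ℕ∞) < t} =
      (Finset.range n : Set ℕ)ᶜ := by
    ext k
    simp only [Set.mem_preimage, Set.mem_ofPred_eq, Finset.coe_range, Set.mem_compl_iff,
      Set.mem_Iio, not_lt, Nat.cast_lt]
    omega
  have hgeom :
      (geometricMeasure (unitInterval.symm p)).real (Finset.range n) = 1 - (p : ℝ) ^ n := by
    rw [← sum_measureReal_singleton]
    simp only [geometricMeasure_real_singleton hq, unitInterval.coe_symm_eq, sub_sub_cancel,
      ← Finset.sum_mul]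
    exact geom_sum_mul_neg (p : ℝ) n
  rw [map_apply (by fun_prop) .of_discrete, hset, ← ofReal_measureReal,
    probReal_compl_eq_one_sub (Finset.measurableSet _), hgeom, sub_sub_cancel]

variable {p}

theorem lifetimeLaw_top (hp : p ≠ 1) : lifetimeLaw p {⊤} = 0 := by
  have hempty : (fun n : ℕ => ((n + 1 : ℕ) : ℕ∞)) ⁻¹' {⊤} = ∅ :=
    Set.eq_empty_of_forall_notMem fun k => ENat.natCast_ne_top _
  rw [lifetimeLaw, if_neg hp, map_apply (by fun_prop) .of_discrete, hempty, measure_empty]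

end Lifetime

section SiteLaw

variable {d : ℕ} (p : unitInterval) (ν : Measure ℕ) [IsProbabilityMeasure ν]

theorem siteLaw_runs (Z : Set (Site d)) (i n : ℕ) : siteLaw d p ν {e | Runs Z e i n} =
    ν {m | i < m} * (stepLaw d Z ^ n * ENNReal.ofReal ((p : ℝ) ^ n)) := by
  have hsteps : {f : ℕ → ℕ → Site d | ∀ k < n, f i k ∈ Z} =
      (fun f => f i) ⁻¹' ((Finset.range n : Set ℕ).pi fun _ => Z) := by
    ext; simp
  have hZ : MeasurableSet ((Finset.range n : Set ℕ).pi fun _ => Z) :=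
    .pi (Finset.countable_toSet _) fun _ _ => .of_discrete
  rw [runs_eq_prod, siteLaw, prod_prod, prod_prod]
  congr 2
  · rw [hsteps, (measurePreserving_eval_infinitePi
      (fun _ : ℕ => infinitePi fun _ : ℕ => stepLaw d) i).measure_preimage hZ.nullMeasurableSet,
      infinitePi_pi _ fun _ _ => .of_discrete, Finset.prod_const, Finset.card_range]
  · rw [← lifetimeLaw_lt]
    exact (measurePreserving_eval_infinitePi (fun _ : ℕ => lifetimeLaw p) i).measure_preimage
      (MeasurableSet.of_discrete (s := {t | (n : ℕ∞) < t})).nullMeasurableSet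

end SiteLaw

section UnitSteps

variable {d : ℕ}

theorem unitSteps_eq_image : unitSteps d =
    (Finset.univ : Finset (Fin d × ℤˣ)).image fun q => Pi.single q.1 (q.2 : ℤ) := by
  ext z
  simp only [mem_unitSteps, Finset.mem_image, Finset.mem_univ, true_and, Prod.exists]
  constructor
  · intro h
    obtain ⟨i, hi⟩ : ∃ i, z i ≠ 0 := by
      by_contra! hcon
      simp [hcon] at h
    have hsplit := Finset.add_sum_erase Finset.univ (fun j => |z j|) (Finset.mem_univ i)
    have hpos : 1 ≤ |z i| := Int.one_le_abs hi
    have hnonneg : 0 ≤ ∑ j ∈ Finset.univ.erase i, |z j| :=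
      Finset.sum_nonneg fun _ _ => abs_nonneg _
    have hzero : ∑ j ∈ Finset.univ.erase i, |z j| = 0 := by omega
    obtain ⟨s, hs⟩ : IsUnit (z i) := Int.isUnit_iff_abs_eq.2 (by omega)
    rw [Finset.sum_eq_zero_iff_of_nonneg fun _ _ => abs_nonneg _] at hzero
    refine ⟨i, s, funext fun j => ?_⟩
    obtain rfl | hj := eq_or_ne j i
    · rw [Pi.single_eq_same, hs]
    · rw [Pi.single_eq_of_ne hj,
        abs_eq_zero.1 (hzero j (Finset.mem_erase.2 ⟨hj, Finset.mem_univ j⟩))]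
  · rintro ⟨i, s, rfl⟩
    rw [Finset.sum_eq_single i (fun j _ hj => by simp [hj]) (by simp), Pi.single_eq_same]
    exact Int.isUnit_iff_abs_eq.1 s.isUnit

theorem single_units_injective :
    Function.Injective fun q : Fin d × ℤˣ => (Pi.single q.1 (q.2 : ℤ) : Site d) := by
  rintro ⟨i, s⟩ ⟨j, t⟩ h
  obtain rfl : i = j := by
    by_contra hij
    have := congrFun h i
    simp [hij] at this
  exact Prod.ext rfl (Units.ext (Pi.single_injective i h))

theorem card_unitSteps : (unitSteps d).card = 2 * d := by
  rw [unitSteps_eq_image, Finset.card_image_of_injective _ single_units_injective, Finset.card_univ,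
    Fintype.card_prod, Fintype.card_fin, Fintype.card_units_int, mul_comm]

open Classical in
theorem stepLaw_apply (hd : 0 < d) (Z : Set (Site d)) :
    stepLaw d Z = (((unitSteps d).filter (· ∈ Z)).card : ℝ≥0∞) / (2 * d : ℕ) := by
  rw [stepLaw, dif_pos (unitSteps_nonempty hd), PMF.toMeasure_uniformOfFinset_apply _ _
    MeasurableSet.of_discrete, card_unitSteps]

theorem stepLaw_singleton_le (hd : 0 < d) (v : Site d) :
    stepLaw d {v} ≤ ((2 * d : ℕ) : ℝ≥0∞)⁻¹ := by
  rw [stepLaw_apply hd, ENNReal.div_eq_inv_mul]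
  refine mul_le_of_le_one_right' (Nat.cast_le_one.2 (Finset.card_le_one.2 fun a ha b hb => ?_))
  simp only [Finset.mem_filter, Set.mem_singleton_iff] at ha hb
  rw [ha.2, hb.2]

theorem le_stepLaw (hd : 0 < d) {Z : Set (Site d)} {J : Finset (Fin d × ℤˣ)}
    (h : ∀ q ∈ J, (Pi.single q.1 (q.2 : ℤ) : Site d) ∈ Z) :
    (J.card : ℝ) / (2 * d) ≤ (stepLaw d).real Z := by
  classical
  have hsub : J.image (fun q => (Pi.single q.1 (q.2 : ℤ) : Site d)) ⊆
      (unitSteps d).filter (· ∈ Z) := by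
    refine Finset.image_subset_iff.2 fun q hq => Finset.mem_filter.2 ⟨?_, h q hq⟩
    rw [unitSteps_eq_image]
    exact Finset.mem_image_of_mem _ (Finset.mem_univ q)
  have hcard := Finset.card_le_card hsub
  rw [Finset.card_image_of_injective _ single_units_injective] at hcard
  rw [measureReal_def, stepLaw_apply hd, ENNReal.toReal_div, ENNReal.toReal_natCast,
    ENNReal.toReal_natCast, Nat.cast_mul, Nat.cast_ofNat]
  gcongr

end UnitSteps

section Layers

variable {d : ℕ} (q : ℕ)

/-- The projection `ℤ^d → ℤ²` to the sum of the first `q` coordinates and the sum of the next `q`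
coordinates; its fibres are the layers. -/
def layer (d q : ℕ) : Site d →+ ℤ × ℤ where
  toFun x :=
    (∑ i ∈ Finset.univ.filter fun i : Fin d => (i : ℕ) < q, x i,
      ∑ i ∈ Finset.univ.filter fun i : Fin d => q ≤ (i : ℕ) ∧ (i : ℕ) < 2 * q, x i)
  map_zero' := by simp
  map_add' x y := by simp [Finset.sum_add_distrib]

theorem layer_single (i : Fin d) (s : ℤ) : layer d q (Pi.single i s) =
    (if (i : ℕ) < q then s else 0, if q ≤ (i : ℕ) ∧ (i : ℕ) < 2 * q then s else 0) := by
  simp [layer]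

theorem card_fin_Ico {a b : ℕ} (hb : b ≤ d) :
    (Finset.univ.filter fun i : Fin d => a ≤ (i : ℕ) ∧ (i : ℕ) < b).card = b - a := by
  rw [← Nat.card_Ico, ← Finset.card_map Fin.valEmbedding]
  congr 1
  ext j
  simp only [Finset.mem_map, Finset.mem_filter, Finset.mem_univ, true_and, Fin.valEmbedding_apply,
    Finset.mem_Ico]
  exact ⟨fun ⟨_, hi, hj⟩ => hj ▸ hi, fun hj => ⟨⟨j, hj.2.trans_le hb⟩, hj, rfl⟩⟩

variable {q}

theorem le_stepLaw_neutral (hd : 0 < d) (hq : 2 * q ≤ d) :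
    1 - 2 * q / d ≤ (stepLaw d).real {z | layer d q z = 0} := by
  let J : Finset (Fin d × ℤˣ) :=
    (Finset.univ.filter fun i : Fin d => 2 * q ≤ (i : ℕ) ∧ (i : ℕ) < d) ×ˢ Finset.univ
  have hJ : J.card = (d - 2 * q) * 2 := by
    rw [Finset.card_product, card_fin_Ico le_rfl, Finset.card_univ, Fintype.card_units_int]
  have hd' : (d : ℝ) ≠ 0 := by exact_mod_cast hd.ne'
  calc 1 - 2 * q / d = (J.card : ℝ) / (2 * d) := by
        rw [hJ]
        push_cast [Nat.cast_sub hq]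
        field_simp
    _ ≤ _ := le_stepLaw hd fun x hx => by
        have hx := (Finset.mem_filter.1 (Finset.mem_product.1 hx).1).2
        rw [Set.mem_ofPred_eq, layer_single, if_neg (by omega), if_neg (by omega),
          Prod.mk_zero_zero]

theorem le_stepLaw_unitVec (hd : 0 < d) (hq : 2 * q ≤ d) (i : Fin 2) :
    (q : ℝ) / (2 * d) ≤ (stepLaw d).real {z | layer d q z = unitVec i} := by
  let J : Finset (Fin d × ℤˣ) :=
    (Finset.univ.filter fun j : Fin d => i * q ≤ (j : ℕ) ∧ (j : ℕ) < i * q + q) ×ˢ {1}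
  have hJ : J.card = q := by
    have hi : (i : ℕ) * q + q ≤ d := by
      fin_cases i <;> simp <;> omega
    rw [Finset.card_product, card_fin_Ico hi, Finset.card_singleton, mul_one,
      Nat.add_sub_cancel_left]
  refine (hJ ▸ le_stepLaw hd fun x hx => ?_ : _)
  have hx := Finset.mem_product.1 hx
  have hpos := (Finset.mem_filter.1 hx.1).2
  rw [Set.mem_ofPred_eq, layer_single, Finset.mem_singleton.1 hx.2]
  fin_cases i <;> simp [unitVec] at hpos ⊢ <;> omega

end Layers

theorem infinitePi_eval_eq_le {ι T : Type*} {X : ι → Type*} [∀ i, MeasurableSpace (X i)]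
    (P : (i : ι) → Measure (X i)) [∀ i, IsProbabilityMeasure (P i)] [Countable T]
    [MeasurableSpace T] [MeasurableSingletonClass T] {i : ι} {f : X i → T} (hf : Measurable f)
    {g : (Π i, X i) → T} (hg : Measurable g) (hdep : DependsOn g {i}ᶜ) {δ : ℝ≥0∞}
    (h : ∀ c, P i {x | f x = c} ≤ δ) : infinitePi P {ω | f (ω i) = g ω} ≤ δ := by
  have mf (c : T) : MeasurableSet {x | f x = c} := hf (.singleton c)
  have key := infinitePi_inter_adapted_le P hg MeasurableSet.univ
    (Bad := fun c => {ω | f (ω i) = c}) (fun c => measurable_pi_apply i (mf c))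
    (fun _ => {i}) δ fun c _ => ⟨fun x y hxy => ?_, fun x y hxy => ?_, ?_⟩
  · simpa only [Set.univ_inter, Set.mem_ofPred_eq, measure_univ, mul_one] using key
  · simp [hdep hxy]
  · simp [hxy i rfl]
  · exact ((measurePreserving_eval_infinitePi P i).measure_preimage
      (mf c).nullMeasurableSet).trans_le (h c)

section Chebyshev

variable {S E : Type*} [MeasurableSpace E] (κ : Measure E) [IsProbabilityMeasure κ] {f : E → ℝ}
  {c : ℝ}

theorem memLp_eval (hf : Measurable f) (hfc : ∀ e, f e ∈ Set.Icc 0 c) (b : S) :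
    MemLp (fun r : S → E => f (r b)) 2 (infinitePi fun _ : S => κ) :=
  .of_bound (hf.comp (measurable_pi_apply b)).aestronglyMeasurable c (.of_forall fun r => by
    rw [Real.norm_eq_abs, abs_of_nonneg (hfc _).1]
    exact (hfc _).2)

theorem expectation_sum_eval (hf : Measurable f) (hfc : ∀ e, f e ∈ Set.Icc 0 c) (B : Finset S) :
    (infinitePi fun _ : S => κ)[∑ b ∈ B, fun r : S → E => f (r b)] = B.card * ∫ e, f e ∂κ := by
  have hint (b : S) : ∫ r, f (r b) ∂infinitePi (fun _ : S => κ) = ∫ e, f e ∂κ := by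
    have hb := measurePreserving_eval_infinitePi (fun _ : S => κ) b
    exact (integral_map hb.aemeasurable hf.aestronglyMeasurable).symm.trans (by rw [hb.map_eq])
  simp only [Finset.sum_apply]
  rw [integral_finsetSum _ fun b _ => (memLp_eval κ hf hfc b).integrable one_le_two]
  simp only [hint, Finset.sum_const, nsmul_eq_mul]

theorem variance_sum_eval_le (hf : Measurable f) (hfc : ∀ e, f e ∈ Set.Icc 0 c) (B : Finset S) :
    variance (∑ b ∈ B, fun r : S → E => f (r b)) (infinitePi fun _ : S => κ) ≤ B.card * c ^ 2 := by
  rw [IndepFun.variance_sum (fun b _ => memLp_eval κ hf hfc b) fun b _ b' _ hbb =>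
    (iIndepFun_infinitePi (P := fun _ : S => κ) (X := fun _ => f) fun _ => hf).indepFun hbb]
  calc ∑ b ∈ B, variance (fun r : S → E => f (r b)) (infinitePi fun _ : S => κ)
      ≤ ∑ _b ∈ B, c ^ 2 := Finset.sum_le_sum fun b _ => by
        have := variance_le_sq_of_bounded (μ := infinitePi fun _ : S => κ)
          (X := fun r : S → E => f (r b)) (.of_forall fun r => hfc (r b))
          (hf.comp (measurable_pi_apply b)).aemeasurable
        nlinarith [sq_nonneg c]
    _ = B.card * c ^ 2 := by rw [Finset.sum_const, nsmul_eq_mul]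

theorem infinitePi_sum_eval_lt_le (hf : Measurable f) (hfc : ∀ e, f e ∈ Set.Icc 0 c) {a t : ℝ}
    (hta : t < a) (ha : a ≤ ∫ e, f e ∂κ) {B : Finset S} (hB : B.Nonempty) :
    infinitePi (fun _ : S => κ) {r | ∑ b ∈ B, f (r b) < t * B.card} ≤
      ENNReal.ofReal (c ^ 2 / ((a - t) ^ 2 * B.card)) := by
  have hBpos : (0 : ℝ) < B.card := by exact_mod_cast hB.card_pos
  have hgap : 0 < a - t := sub_pos.2 hta
  have hchebyshev := meas_ge_le_variance_div_sq
    (memLp_finsetSum' B fun b _ => memLp_eval κ hf hfc b) (mul_pos hgap hBpos)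
  refine (measure_mono fun r hr => ?_).trans (hchebyshev.trans (ENNReal.ofReal_le_ofReal ?_))
  · have hr : ∑ b ∈ B, f (r b) < t * B.card := hr
    rw [Set.mem_ofPred_eq, expectation_sum_eval κ hf hfc, Finset.sum_apply, abs_sub_comm]
    refine le_trans ?_ (le_abs_self _)
    nlinarith
  · calc _ ≤ (B.card * c ^ 2) / ((a - t) * B.card) ^ 2 := by
          gcongr
          exact variance_sum_eval_le κ hf hfc B
      _ = _ := by field_simp

end Chebyshev

section Collisions

variable {d : ℕ}

theorem stepLaw_pi_sum_eq_le (hd : 0 < d) {n : ℕ} (hn : 1 ≤ n) (v : Site d) :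
    infinitePi (fun _ : ℕ => stepLaw d) {s | ∑ k ∈ Finset.range n, s k = v} ≤
      ((2 * d : ℕ) : ℝ≥0∞)⁻¹ := by
  obtain ⟨n, rfl⟩ := Nat.exists_eq_add_of_le' hn
  simp only [Finset.sum_range_succ, ← eq_sub_iff_add_eq']
  refine infinitePi_eval_eq_le (fun _ : ℕ => stepLaw d) measurable_id (by fun_prop)
    (fun s s' hs => ?_) (stepLaw_singleton_le hd)
  rw [Finset.sum_congr rfl fun k hk => hs k (Finset.mem_range.1 hk).ne]

theorem stepLaw_pi_sum_eq_sum_le (hd : 0 < d) {n m : ℕ} (hnm : n < m) :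
    infinitePi (fun _ : ℕ => stepLaw d)
      {s | ∑ k ∈ Finset.range n, s k = ∑ k ∈ Finset.range m, s k} ≤ ((2 * d : ℕ) : ℝ≥0∞)⁻¹ := by
  simp only [← Finset.sum_range_add_sum_Ico _ hnm.le, Finset.sum_eq_sum_Ico_succ_bot hnm,
    left_eq_add, ← eq_neg_iff_add_eq_zero]
  refine infinitePi_eval_eq_le (fun _ : ℕ => stepLaw d) measurable_id (by fun_prop)
    (fun s s' hs => ?_) (stepLaw_singleton_le hd)
  rw [Finset.sum_congr rfl fun k hk => hs k (Nat.lt_of_succ_le (Finset.mem_Ico.1 hk).1).ne']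

variable (p : unitInterval) (ν : Measure ℕ) [IsProbabilityMeasure ν]

theorem measurePreserving_steps : MeasurePreserving (fun e : SiteData d => e.2.1) (siteLaw d p ν)
    (infinitePi fun _ : ℕ => infinitePi fun _ : ℕ => stepLaw d) :=
  measurePreserving_fst.comp measurePreserving_snd

theorem siteLaw_add_displ_eq_le (hd : 0 < d) {n : ℕ} (hn : 1 ≤ n) (i : ℕ) (x v : Site d) :
    siteLaw d p ν {e | x + displ e i n = v} ≤ ((2 * d : ℕ) : ℝ≥0∞)⁻¹ := by
  have hm : Measurable fun s : ℕ → Site d => ∑ k ∈ Finset.range n, s k := by fun_prop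
  simp only [← eq_sub_iff_add_eq']
  exact (((measurePreserving_eval_infinitePi _ i).comp
    (measurePreserving_steps p ν)).measure_preimage
      (hm (.singleton (v - x))).nullMeasurableSet).trans_le (stepLaw_pi_sum_eq_le hd hn _)

theorem siteLaw_displ_eq_displ_le (hd : 0 < d) {i j n m : ℕ} (hn : 1 ≤ n)
    (hne : (i, n) ≠ (j, m)) :
    siteLaw d p ν {e | displ e i n = displ e j m} ≤ ((2 * d : ℕ) : ℝ≥0∞)⁻¹ := by
  have hsum (n : ℕ) : Measurable fun s : ℕ → Site d => ∑ k ∈ Finset.range n, s k := by fun_prop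
  have hsame {n m : ℕ} (hnm : n < m) :
      siteLaw d p ν {e | displ e i n = displ e i m} ≤ ((2 * d : ℕ) : ℝ≥0∞)⁻¹ :=
    (((measurePreserving_eval_infinitePi _ i).comp (measurePreserving_steps p ν)).measure_preimage
      (measurableSet_eq_fun (hsum n) (hsum m)).nullMeasurableSet).trans_le
      (stepLaw_pi_sum_eq_sum_le hd hnm)
  obtain rfl | hij := eq_or_ne i j
  · rcases lt_trichotomy n m with h | rfl | h
    · exact hsame h
    · exact absurd rfl hne
    · simpa only [eq_comm] using hsame h
  · have hother : Measurable fun f : ℕ → ℕ → Site d => ∑ k ∈ Finset.range m, f j k := by fun_prop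
    refine ((measurePreserving_steps p ν).measure_preimage (measurableSet_eq_fun
      ((hsum n).comp (measurable_pi_apply i)) hother).nullMeasurableSet).trans_le ?_
    refine infinitePi_eval_eq_le (fun _ : ℕ => infinitePi fun _ : ℕ => stepLaw d) (hsum n) hother
      (fun f f' hf => ?_) (stepLaw_pi_sum_eq_le hd hn)
    simp only [hf j hij.symm]

/-- For `u = (x, i, n)`, the position after `n` steps of the `i`-th particle from `x`. -/
def position (r : Site d → SiteData d) (u : Site d × ℕ × ℕ) : Site d :=
  u.1 + displ (r u.1) u.2.1 u.2.2

theorem measure_position_eq_le (hd : 0 < d) {u : Site d × ℕ × ℕ} (hu : 1 ≤ u.2.2) (v : Site d) :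
    infinitePi (fun _ : Site d => siteLaw d p ν) {r | position r u = v} ≤
      ((2 * d : ℕ) : ℝ≥0∞)⁻¹ := by
  obtain ⟨x, i, n⟩ := u
  have hm : Measurable fun e : SiteData d => x + displ e i n := by fun_prop
  refine infinitePi_eval_eq_le (fun _ : Site d => siteLaw d p ν) hm (measurable_const (a := v))
    (fun _ _ _ => rfl) fun c => siteLaw_add_displ_eq_le p ν hd hu i x c

theorem measure_position_eq_position_le (hd : 0 < d) {u w : Site d × ℕ × ℕ} (hu : 1 ≤ u.2.2)
    (hne : u ≠ w) : infinitePi (fun _ : Site d => siteLaw d p ν)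
      {r | position r u = position r w} ≤ ((2 * d : ℕ) : ℝ≥0∞)⁻¹ := by
  obtain ⟨x, i, n⟩ := u
  obtain ⟨y, j, m⟩ := w
  simp only [position]
  obtain rfl | hxy := eq_or_ne x y
  · have h := ((measurePreserving_eval_infinitePi (fun _ : Site d => siteLaw d p ν)
      x).measure_preimage (measurableSet_eq_fun (measurable_displ i n)
        (measurable_displ j m)).nullMeasurableSet).trans_le
      (siteLaw_displ_eq_displ_le p ν hd hu (by simpa using hne))
    exact (measure_mono fun r hr => add_left_cancel hr).trans h
  · have hm : Measurable fun e : SiteData d => x + displ e i n := by fun_prop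
    have hother : Measurable fun r : Site d → SiteData d => y + displ (r y) j m := by fun_prop
    refine infinitePi_eval_eq_le (fun _ : Site d => siteLaw d p ν) hm hother
      (fun r r' h => by simp only [h y hxy.symm])
      fun c => siteLaw_add_displ_eq_le p ν hd hu i x c

theorem measure_collision_of_le (hd : 0 < d) {u : Site d × ℕ × ℕ} (hu : 1 ≤ u.2.2)
    (J : Finset (Site d × ℕ × ℕ)) (V : Finset (Site d)) :
    infinitePi (fun _ : Site d => siteLaw d p ν)
      ((⋃ w ∈ J.filter (u ≠ ·), {r | position r u = position r w}) ∪
        ⋃ v ∈ V, {r | position r u = v}) ≤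
      (J.card + V.card) * ((2 * d : ℕ) : ℝ≥0∞)⁻¹ := by
  rw [add_mul]
  refine (measure_union_le _ _).trans (add_le_add ?_ ?_)
  · calc _ ≤ ∑ _w ∈ J.filter (u ≠ ·), ((2 * d : ℕ) : ℝ≥0∞)⁻¹ :=
          (measure_biUnion_finset_le _ _).trans (Finset.sum_le_sum fun w hw =>
            measure_position_eq_position_le p ν hd hu (Finset.mem_filter.1 hw).2)
      _ ≤ J.card * ((2 * d : ℕ) : ℝ≥0∞)⁻¹ := by
          rw [Finset.sum_const, nsmul_eq_mul]
          gcongr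
          exact Finset.filter_subset _ _
  · calc _ ≤ ∑ _v ∈ V, ((2 * d : ℕ) : ℝ≥0∞)⁻¹ :=
          (measure_biUnion_finset_le _ _).trans
            (Finset.sum_le_sum fun v _ => measure_position_eq_le p ν hd hu v)
      _ = V.card * ((2 * d : ℕ) : ℝ≥0∞)⁻¹ := by rw [Finset.sum_const, nsmul_eq_mul]

theorem measure_collision_le (hd : 0 < d) {J : Finset (Site d × ℕ × ℕ)}
    (hJ : ∀ u ∈ J, 1 ≤ u.2.2) (V : Finset (Site d)) :
    infinitePi (fun _ : Site d => siteLaw d p ν)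
      {r | ¬ (Set.InjOn (position r) J ∧ ∀ u ∈ J, position r u ∉ V)} ≤
      (J.card * (J.card + V.card) : ℕ) * ((2 * d : ℕ) : ℝ≥0∞)⁻¹ := by
  have hsub : {r | ¬ (Set.InjOn (position r) J ∧ ∀ u ∈ J, position r u ∉ V)} ⊆
      ⋃ u ∈ J, (⋃ w ∈ J.filter (u ≠ ·), {r | position r u = position r w}) ∪
        ⋃ v ∈ V, {r | position r u = v} := by
    intro r hr
    rw [Set.mem_ofPred_eq, not_and_or] at hr
    rcases hr with hr | hr
    · simp only [Set.InjOn] at hr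
      push Not at hr
      obtain ⟨u, hu, w, hw, heq, hne⟩ := hr
      exact Set.mem_biUnion hu (.inl (Set.mem_biUnion (Finset.mem_filter.2 ⟨hw, hne⟩) heq))
    · push Not at hr
      obtain ⟨u, hu, hV⟩ := hr
      exact Set.mem_biUnion hu (.inr (Set.mem_biUnion hV rfl))
  calc _ ≤ ∑ _u ∈ J, (J.card + V.card) * ((2 * d : ℕ) : ℝ≥0∞)⁻¹ := (measure_mono hsub).trans
        ((measure_biUnion_finset_le _ _).trans
          (Finset.sum_le_sum fun u hu => measure_collision_of_le p ν hd (hJ u hu) J V))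
    _ = (J.card * (J.card + V.card) : ℕ) * ((2 * d : ℕ) : ℝ≥0∞)⁻¹ := by
        rw [Finset.sum_const, nsmul_eq_mul]
        push_cast
        ring

end Collisions

section Found

variable {d : ℕ} (Z : Set (Site d)) (I : Finset (ℕ × ℕ))

open Classical in
/-- The pairs `(i, n)` in `I` such that the `i`-th particle takes at least `n` steps, the first `n`
of them in `Z`. -/
noncomputable def running (e : SiteData d) : Finset (ℕ × ℕ) := I.filter fun q => Runs Z e q.1 q.2

theorem card_running_le (e : SiteData d) : (running Z I e).card ≤ I.card := by
  classical exact Finset.card_filter_le _ _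

theorem integral_card_running (p : unitInterval) (ν : Measure ℕ) [IsProbabilityMeasure ν] :
    ∫ e, ((running Z I e).card : ℝ) ∂siteLaw d p ν =
      ∑ q ∈ I, (siteLaw d p ν).real {e | Runs Z e q.1 q.2} := by
  classical
  have hsum (e : SiteData d) : ((running Z I e).card : ℝ) =
      ∑ q ∈ I, {e | Runs Z e q.1 q.2}.indicator 1 e := by
    rw [running, Finset.card_filter]
    push_cast
    exact Finset.sum_congr rfl fun q _ => by simp [Set.indicator_apply]
  simp only [hsum]
  rw [integral_finsetSum (f := fun q => {e | Runs Z e q.1 q.2}.indicator 1) I fun q _ =>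
    (integrable_const (1 : ℝ)).indicator (measurableSet_runs Z q.1 q.2)]
  exact Finset.sum_congr rfl fun q _ => integral_indicator_one (measurableSet_runs Z q.1 q.2)

theorem measurable_running : Measurable (running Z I) := by
  refine measurable_finset_iff.2 fun q => ?_
  simp only [running, Finset.mem_filter]
  exact measurable_const.and (measurableSet_setOfPred.1 (measurableSet_runs Z q.1 q.2))

/-- The sites where the particles from `x` are found at the times prescribed by `I`, when they run
inside `Z`. -/
noncomputable def found (x : Site d) (e : SiteData d) : Finset (Site d) :=
  (running Z I e).image fun q => x + displ e q.1 q.2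

theorem card_found_le (x : Site d) (e : SiteData d) : (found Z I x e).card ≤ I.card :=
  Finset.card_image_le.trans (card_running_le Z I e)

variable {Z I} in
theorem mem_found {x y : Site d} {e : SiteData d} :
    y ∈ found Z I x e ↔ ∃ q ∈ I, Runs Z e q.1 q.2 ∧ x + displ e q.1 q.2 = y := by
  simp only [found, running, Finset.mem_image, Finset.mem_filter, and_assoc]

theorem measurable_found (x : Site d) : Measurable (found Z I x) := by
  refine measurable_finset_iff.2 fun y => measurableSet_setOfPred.1 ?_
  simp only [mem_found, ← exists_prop, Set.ofPred_exists]
  refine .biUnion I.countable_toSet fun q _ => ?_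
  simp only [exists_prop]
  have hm : Measurable fun e : SiteData d => x + displ e q.1 q.2 := by fun_prop
  exact (measurableSet_runs Z q.1 q.2).inter (hm (.singleton y))

variable {Z I}

theorem sum_card_running_le {r : Site d → SiteData d} {B V : Finset (Site d)}
    (hinj : Set.InjOn (position r) (B ×ˢ I : Finset (Site d × ℕ × ℕ)))
    (hV : ∀ u ∈ B ×ˢ I, position r u ∉ V) :
    ∑ x ∈ B, (running Z I (r x)).card ≤ (discovered (found Z I) B r \ V).card := by
  classical
  let R := (B ×ˢ I).filter fun u => Runs Z (r u.1) u.2.1 u.2.2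
  calc ∑ x ∈ B, (running Z I (r x)).card = R.card := by
        simp only [R, running, Finset.card_filter, Finset.sum_product]
    _ = (R.image (position r)).card :=
        (Finset.card_image_of_injOn (hinj.mono (Finset.filter_subset _ _))).symm
    _ ≤ (discovered (found Z I) B r \ V).card := by
        refine Finset.card_le_card (Finset.image_subset_iff.2 fun u hu => ?_)
        obtain ⟨huBI, hrun⟩ := Finset.mem_filter.1 hu
        obtain ⟨huB, huI⟩ := Finset.mem_product.1 huBI
        exact Finset.mem_sdiff.2
          ⟨Finset.mem_biUnion.2 ⟨u.1, huB, mem_found.2 ⟨u.2, huI, hrun, rfl⟩⟩, hV u huBI⟩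

theorem measure_found_lt_le (p : unitInterval) (ν : Measure ℕ) [IsProbabilityMeasure ν]
    (hd : 0 < d) (hI : ∀ q ∈ I, 1 ≤ q.2) {a t : ℝ} (hta : t < a)
    (ha : a ≤ ∑ q ∈ I, (siteLaw d p ν).real {e | Runs Z e q.1 q.2}) (V : Finset (Site d))
    {B : Finset (Site d)} (hB : B.Nonempty) :
    infinitePi (fun _ : Site d => siteLaw d p ν)
      {r | ((discovered (found Z I) B r \ V).card : ℝ) < t * B.card} ≤
      ENNReal.ofReal ((I.card : ℝ) ^ 2 / ((a - t) ^ 2 * B.card)) +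
        ((B.card * I.card) * (B.card * I.card + V.card) : ℕ) * ((2 * d : ℕ) : ℝ≥0∞)⁻¹ := by
  have hfew := infinitePi_sum_eval_lt_le (S := Site d) (siteLaw d p ν)
    (f := fun e => ((running Z I e).card : ℝ)) (c := I.card)
    ((Measurable.of_discrete (f := fun A : Finset (ℕ × ℕ) => (A.card : ℝ))).comp
      (measurable_running Z I))
    (fun e => ⟨by positivity, Nat.cast_le.2 (card_running_le Z I e)⟩) hta
    (ha.trans_eq (integral_card_running Z I p ν).symm) hB
  have hcollision := measure_collision_le p ν hd (J := B ×ˢ I)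
    (fun u hu => hI u.2 (Finset.mem_product.1 hu).2) V
  rw [Finset.card_product] at hcollision
  refine (measure_mono fun r hr => ?_).trans ((measure_union_le _ _).trans
    (add_le_add hfew hcollision))
  by_contra hcon
  rw [Set.mem_union, not_or, Set.mem_ofPred_eq, Set.mem_ofPred_eq, not_lt, not_not] at hcon
  obtain ⟨hmany, hinj, hV⟩ := hcon
  have hle : (∑ x ∈ B, ((running Z I (r x)).card : ℝ)) ≤ (discovered (found Z I) B r \ V).card := by
    exact_mod_cast sum_card_running_le hinj hV
  exact (hmany.trans hle).not_gt hr

end Found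

section Cluster

theorem measurableSet_reflTransGen {Ω S : Type*} [MeasurableSpace Ω] [Countable S]
    {R : Ω → S → S → Prop} (hR : ∀ x y, MeasurableSet {r | R r x y}) (a y : S) :
    MeasurableSet {r | Relation.ReflTransGen (R r) a y} := by
  have hpath (l : List S) (a : S) : MeasurableSet {r | (a :: l).IsChain (R r)} := by
    induction l generalizing a with
    | nil => simp
    | cons x l ih =>
      simp only [List.isChain_cons_cons]
      exact (hR a x).inter (ih x)
  have hiff : {r | Relation.ReflTransGen (R r) a y} =
      ⋃ (l : List S) (_ : (a :: l).getLast (List.cons_ne_nil a l) = y),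
        {r | (a :: l).IsChain (R r)} := by
    ext r
    simp only [Set.mem_ofPred_eq, Set.mem_iUnion, exists_prop]
    constructor
    · intro h
      obtain ⟨l, hl, hy⟩ := List.exists_isChain_cons_of_relationReflTransGen h
      exact ⟨l, hy, hl⟩
    · rintro ⟨l, hy, hl⟩
      exact List.relationReflTransGen_of_exists_isChain_cons l hl hy
  rw [hiff]
  exact .iUnion fun l => .iUnion fun _ => hpath l a

theorem measurableSet_infinite {Ω S : Type*} [MeasurableSpace Ω] [Countable S]
    {P : Ω → S → Prop} (hP : ∀ y, MeasurableSet {r | P r y}) :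
    MeasurableSet {r | {y | P r y}.Infinite} := by
  have hiff : {r | {y | P r y}.Infinite} = ⋂ F : Finset S, ⋃ y ∈ {y | y ∉ F}, {r | P r y} := by
    ext r
    simp only [Set.mem_ofPred_eq, Set.mem_iInter, Set.mem_iUnion, exists_prop]
    refine ⟨fun h F => ?_, fun h hfin => ?_⟩
    · obtain ⟨y, hy, hyF⟩ := h.exists_notMem_finset F
      exact ⟨y, hyF, hy⟩
    · obtain ⟨y, hy, hPy⟩ := h hfin.toFinset
      exact hy (hfin.mem_toFinset.2 hPy)
  rw [hiff]
  exact .iInter fun F => .biUnion (Set.to_countable _) fun y _ => hP y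

variable {d : ℕ} (p : unitInterval) (ν : Measure ℕ) [IsProbabilityMeasure ν]

/-- The sites whose particles are eventually activated when at first only the particles at `a` are
active. -/
def cluster (r : Site d → SiteData d) (a : Site d) : Set (Site d) :=
  {y | Relation.ReflTransGen (fun x z => Visits (r x) x z) a y}

theorem measurableSet_infinite_cluster (a : Site d) :
    MeasurableSet {r : Site d → SiteData d | (cluster r a).Infinite} :=
  measurableSet_infinite fun y => measurableSet_reflTransGen
    (fun x z => (measurable_pi_apply x : Measurable fun r : Site d → SiteData d => r x)
      (measurableSet_visits x z)) a y

theorem infinite_cluster_translate {r : Site d → SiteData d} {a : Site d}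
    (h : (cluster r a).Infinite) : (cluster (fun x => r (x + a)) 0).Infinite := by
  refine Set.infinite_of_injOn_mapsTo (f := (· - a)) sub_left_injective.injOn (fun y hy => ?_) h
  have hstep (x z : Site d) (h : Visits (r x) x z) : Visits (r (x - a + a)) (x - a) (z - a) := by
    obtain ⟨i, n, hrun, rfl⟩ := h
    exact ⟨i, n, by rwa [sub_add_cancel], by rw [sub_add_cancel, add_sub_right_comm]⟩
  have hlift := Relation.ReflTransGen.lift (p := fun x z => Visits (r (x + a)) x z) (· - a) hstep
    a y hy
  rwa [Function.onFun_apply, sub_self] at hlift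

theorem measure_infinite_cluster_le (a : Site d) :
    infinitePi (fun _ : Site d => siteLaw d p ν) {r | (cluster r a).Infinite} ≤
      infinitePi (fun _ : Site d => siteLaw d p ν) {r | (cluster r 0).Infinite} := by
  set μ := infinitePi fun _ : Site d => siteLaw d p ν
  have htranslate : MeasurePreserving (fun r x => r (x + a)) μ μ :=
    ⟨by fun_prop, map_infinitePi_infinitePi_of_inj (P := fun _ : Site d => siteLaw d p ν)
      (f := fun x : Site d => x + a) (add_left_injective a)⟩
  calc μ {r | (cluster r a).Infinite}
      ≤ μ ((fun r x => r (x + a)) ⁻¹' {r | (cluster r 0).Infinite}) :=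
        measure_mono fun r hr => infinite_cluster_translate hr
    _ = μ {r | (cluster r 0).Infinite} :=
        htranslate.measure_preimage (measurableSet_infinite_cluster 0).nullMeasurableSet

theorem frogLaw_survives_pos {a : Site d}
    (h : 0 < infinitePi (fun _ : Site d => siteLaw d p ν) {r | (cluster r a).Infinite}) :
    0 < frogLaw d p ν {ω | Survives ω} := by
  have hpos := h.trans_le (measure_infinite_cluster_le p ν a)
  rw [← (measurePreserving_toField d p ν).measure_preimage
    (measurableSet_infinite_cluster 0).nullMeasurableSet] at hpos
  refine hpos.trans_le (measure_mono fun ω hω => survives_of_infinite ?_)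
  have hω : (cluster (toField ω) 0).Infinite := hω
  refine hω.mono fun y hy => reachable_iff_activationTime_lt_top.1 ?_
  simpa only [cluster, Set.mem_ofPred_eq, visits_toField_iff] using hy

end Cluster

section Truncation

variable {ν : Measure ℕ}

theorem tsum_measure_lt (hint : Integrable (fun n : ℕ => (n : ℝ)) ν) :
    ∑' i : ℕ, ν {m | i < m} = ENNReal.ofReal (∫ n : ℕ, (n : ℝ) ∂ν) := by
  have hcount (n : ℕ) : ∑' i : ℕ, {m | i < m}.indicator 1 n = ENNReal.ofReal n := by
    rw [tsum_eq_sum (s := Finset.range n) fun i hi => Set.indicator_of_notMem (by simpa using hi) _,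
      Finset.sum_congr rfl fun i hi => Set.indicator_of_mem (by simpa using hi) _]
    simp
  calc ∑' i : ℕ, ν {m | i < m} = ∑' i : ℕ, ∫⁻ n, {m | i < m}.indicator 1 n ∂ν := by
        simp only [lintegral_indicator_one MeasurableSet.of_discrete]
    _ = ∫⁻ n, ENNReal.ofReal n ∂ν := by
        rw [← lintegral_tsum fun i => Measurable.of_discrete.aemeasurable]
        simp only [hcount]
    _ = ENNReal.ofReal (∫ n : ℕ, (n : ℝ) ∂ν) :=
        (ofReal_integral_eq_lintegral_ofReal hint (.of_forall fun n => n.cast_nonneg)).symm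

theorem tendsto_sum_measureReal_lt [IsFiniteMeasure ν]
    (hint : Integrable (fun n : ℕ => (n : ℝ)) ν) :
    Tendsto (fun K => ∑ i ∈ Finset.range K, ν.real {m | i < m}) atTop
      (𝓝 (∫ n : ℕ, (n : ℝ) ∂ν)) := by
  have hsum := tsum_measure_lt hint
  have h : HasSum (fun i => ν.real {m | i < m}) (∑' i : ℕ, ν {m | i < m}).toReal :=
    ENNReal.tsum_toReal_eq (fun i => measure_ne_top ν _) ▸ ENNReal.hasSum_toReal (by simp [hsum])
  rw [hsum, ENNReal.toReal_ofReal (integral_nonneg fun n => n.cast_nonneg)] at h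
  exact h.tendsto_sum_nat

theorem tendsto_sum_Icc_one_pow {x : ℝ} (h0 : 0 ≤ x) (h1 : x < 1) :
    Tendsto (fun K => ∑ n ∈ Finset.Icc 1 K, x ^ n) atTop (𝓝 (x / (1 - x))) := by
  refine (((hasSum_geometric_of_lt_one h0 h1).mul_left x).tendsto_sum_nat).congr fun K => ?_
  rw [Finset.range_eq_Ico, ← Finset.Ico_add_one_right_eq_Icc,
    ← Finset.sum_Ico_add' (fun n => x ^ n) 0 K 1]
  simp only [pow_succ']

theorem exists_truncation [IsFiniteMeasure ν] (hint : Integrable (fun n : ℕ => (n : ℝ)) ν) {x : ℝ}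
    (h0 : 0 ≤ x) (h1 : x < 1) (h : 1 < x * (1 + ∫ n : ℕ, (n : ℝ) ∂ν)) :
    ∃ K : ℕ, 1 < (∑ i ∈ Finset.range K, ν.real {m | i < m}) * ∑ n ∈ Finset.Icc 1 K, x ^ n := by
  have hlim : 1 < (∫ n : ℕ, (n : ℝ) ∂ν) * (x / (1 - x)) := by
    rw [← mul_div_assoc, lt_div_iff₀ (by linarith)]
    linarith
  exact (((tendsto_sum_measureReal_lt hint).mul (tendsto_sum_Icc_one_pow h0 h1)).eventually
    (lt_mem_nhds hlim)).exists

end Truncation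

section FrogRule

variable {d q : ℕ} {I : Finset (ℕ × ℕ)} {x y : Site d} {e : SiteData d}

theorem layer_of_mem_found_neutral (h : y ∈ found {z | layer d q z = 0} I x e) :
    layer d q y = layer d q x := by
  obtain ⟨u, -, hrun, rfl⟩ := mem_found.1 h
  rw [map_add, displ, _root_.map_sum,
    Finset.sum_eq_zero fun k hk => hrun.2.2 k (Finset.mem_range.1 hk),
    add_zero]

theorem layer_of_mem_found_first {w : ℤ × ℤ}
    (h : y ∈ found {z | layer d q z = w} {(0, 1)} x e) : layer d q y = layer d q x + w := by
  obtain ⟨u, hu, hrun, rfl⟩ := mem_found.1 h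
  obtain rfl := Finset.mem_singleton.1 hu
  rw [map_add, displ, Finset.sum_range_one, (hrun.2.2 0 one_pos).out]

theorem visits_of_mem_found {Z : Set (Site d)} (h : y ∈ found Z I x e) : Visits e x y := by
  obtain ⟨u, -, hrun, hy⟩ := mem_found.1 h
  exact ⟨u.1, u.2, ⟨hrun.1, hrun.2.1, fun _ _ => trivial⟩, hy⟩

/-- The exploration of the frog model in the layers of `ℤ^d`: inside a layer it uses the particles
`i < K` during at most `K` neutral steps, and between layers the first step of the first
particle. -/
noncomputable def frogRule (d q K L M : ℕ) : LayeredRule (Site d) (SiteData d) where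
  layer := layer d q
  child := found {z | layer d q z = 0} (Finset.range K ×ˢ Finset.Icc 1 K)
  exit i := found {z | layer d q z = unitVec i} {(0, 1)}
  gens := L
  quota := M
  layer_child := layer_of_mem_found_neutral
  layer_exit := layer_of_mem_found_first
  measurable_child := measurable_found _ _
  measurable_exit _ := measurable_found _ _

theorem card_child_frogRule_le {K L M : ℕ} (x : Site d) (e : SiteData d) :
    ((frogRule d q K L M).child x e).card ≤ K * K :=
  (card_found_le _ _ x e).trans_eq (by simp)

theorem infinite_cluster_of_leads {K L M : ℕ} {r : Site d → SiteData d} {a : Site d}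
    (h : {y | Relation.ReflTransGen ((frogRule d q K L M).Leads r) a y}.Infinite) :
    (cluster r a).Infinite :=
  h.mono <| Relation.ReflTransGen.mono
    (fun _ _ hlead => hlead.elim visits_of_mem_found fun ⟨_, hi⟩ => visits_of_mem_found hi) a

theorem exists_finset_layer_zero (hq : 2 * q < d) (M : ℕ) :
    ∃ A : Finset (Site d), A.card = M ∧ ∀ x ∈ A, layer d q x = 0 := by
  have hinj : Function.Injective fun k : ℕ => (Pi.single ⟨2 * q, hq⟩ (k : ℤ) : Site d) :=
    (Pi.single_injective _).comp Nat.cast_injective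
  refine ⟨(Finset.range M).map ⟨_, hinj⟩, by simp, fun x hx => ?_⟩
  obtain ⟨k, -, rfl⟩ := Finset.mem_map.1 hx
  rw [Function.Embedding.coeFn_mk, layer_single, if_neg (by simp only; omega),
    if_neg (by simp only; omega), Prod.mk_zero_zero]

end FrogRule

section Survival

variable {d : ℕ} (p : unitInterval) (ν : Measure ℕ) [IsProbabilityMeasure ν]

/-- With at most `s` sites and `n` particle times per site there are too few pairs to collide. -/
theorem measure_found_lt_le_two_mul {Z : Set (Site d)} {I : Finset (ℕ × ℕ)} {B V : Finset (Site d)}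
    {M n s : ℕ} {a t : ℝ} {δ : ℝ≥0∞} (hd : 0 < d) (hI : ∀ q ∈ I, 1 ≤ q.2) (hIn : I.card ≤ n)
    (hta : t < a) (ha : a ≤ ∑ q ∈ I, (siteLaw d p ν).real {e | Runs Z e q.1 q.2})
    (hM : 0 < M) (hMB : M ≤ B.card) (hBs : B.card ≤ s) (hVs : V.card ≤ s)
    (hmean : ENNReal.ofReal ((n : ℝ) ^ 2 / ((a - t) ^ 2 * M)) ≤ δ)
    (hcoll : ((s * n) * (s * n + s) : ℕ) * ((2 * d : ℕ) : ℝ≥0∞)⁻¹ ≤ δ) :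
    infinitePi (fun _ : Site d => siteLaw d p ν)
      {r | ((discovered (found Z I) B r \ V).card : ℝ) < t * B.card} ≤ 2 * δ := by
  have hta' : 0 < a - t := sub_pos.2 hta
  have hM' : (0 : ℝ) < M := by exact_mod_cast hM
  rw [two_mul]
  refine (measure_found_lt_le p ν hd hI hta ha V (Finset.card_pos.1 (hM.trans_le hMB))).trans
    (add_le_add (le_trans ?_ hmean) (le_trans ?_ hcoll))
  · gcongr
  · gcongr

variable {q K L M : ℕ} {θ : ℝ} {δ : ℝ≥0∞} (hM : 0 < M) (hθ : 0 < θ) (hq : 2 * q < d)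
  (hmean : ENNReal.ofReal (((1 + K * K : ℕ) : ℝ) ^ 2 / (θ ^ 2 * M)) ≤ δ)
  (hcoll : (((1 + K * K) ^ L * M * (1 + K * K)) *
    ((1 + K * K) ^ L * M * (1 + K * K) + (1 + K * K) ^ L * M) : ℕ) * ((2 * d : ℕ) : ℝ≥0∞)⁻¹ ≤ δ)
  (hchild : 1 + 2 * θ ≤ ∑ u ∈ Finset.range K ×ˢ Finset.Icc 1 K,
    (siteLaw d p ν).real {e | Runs {z | layer d q z = 0} e u.1 u.2})
  (hexit : ∀ i, 2 * θ ≤ (siteLaw d p ν).real {e | Runs {z | layer d q z = unitVec i} e 0 1})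
include hM hθ hq hmean hcoll

include hchild in
theorem measure_child_lt_le {j : ℕ} {B V : Finset (Site d)} (hB : ⌈(1 + θ) ^ j * M⌉₊ ≤ B.card)
    (hVB : (V ∪ B).card ≤ (1 + K * K) ^ L * M) :
    infinitePi (fun _ : Site d => siteLaw d p ν)
      {r | (discovered (frogRule d q K L M).child B r \ (V ∪ B)).card <
        ⌈(1 + θ) ^ (j + 1) * M⌉₊} ≤ 2 * δ := by
  have hjB : (1 + θ) ^ j * M ≤ B.card := Nat.ceil_le.1 hB
  have hMB : (M : ℝ) ≤ B.card :=
    (le_mul_of_one_le_left M.cast_nonneg (one_le_pow₀ (by linarith))).trans hjB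
  refine (measure_mono fun r hr => ?_).trans (measure_found_lt_le_two_mul p ν
    (I := Finset.range K ×ˢ Finset.Icc 1 K) (V := V ∪ B) (t := 1 + θ) (by omega)
    (fun u hu => (Finset.mem_Icc.1 (Finset.mem_product.1 hu).2).1) (by simp) (by linarith) hchild
    hM (by exact_mod_cast hMB) ((Finset.card_le_card Finset.subset_union_right).trans hVB) hVB
    (by rwa [show 1 + 2 * θ - (1 + θ) = θ by ring]) hcoll)
  calc ((discovered (frogRule d q K L M).child B r \ (V ∪ B)).card : ℝ)
      < (1 + θ) ^ (j + 1) * M := Nat.lt_ceil.1 hr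
    _ = (1 + θ) * ((1 + θ) ^ j * M) := by ring
    _ ≤ (1 + θ) * B.card := by gcongr

variable (hL : 1 ≤ θ * (1 + θ) ^ L)
include hexit hL

theorem measure_exit_lt_le (i : Fin 2) {B : Finset (Site d)} (hB : ⌈(1 + θ) ^ L * M⌉₊ ≤ B.card)
    (hBs : B.card ≤ (1 + K * K) ^ L * M) :
    infinitePi (fun _ : Site d => siteLaw d p ν)
      {r | (discovered ((frogRule d q K L M).exit i) B r).card < M} ≤ 2 * δ := by
  have hLB : (1 + θ) ^ L * M ≤ B.card := Nat.ceil_le.1 hB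
  have hMB : (M : ℝ) ≤ B.card :=
    (le_mul_of_one_le_left M.cast_nonneg (one_le_pow₀ (by linarith))).trans hLB
  refine (measure_mono fun r hr => ?_).trans (measure_found_lt_le_two_mul p ν (I := {(0, 1)})
    (V := ∅) (a := 2 * θ) (t := θ) (by omega) (by simp) (by simp) (by linarith)
    (by simpa only [Finset.sum_singleton] using hexit i) hM (by exact_mod_cast hMB) hBs (by simp)
    (by rwa [show 2 * θ - θ = θ by ring]) hcoll)
  rw [Set.mem_ofPred_eq, Finset.sdiff_empty]
  calc ((discovered ((frogRule d q K L M).exit i) B r).card : ℝ) < M := by exact_mod_cast hr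
    _ ≤ (θ * (1 + θ) ^ L) * M := le_mul_of_one_le_left M.cast_nonneg hL
    _ = θ * ((1 + θ) ^ L * M) := by ring
    _ ≤ θ * B.card := by gcongr

include hchild in
theorem frogLaw_survives_pos_of_rates (hLδ : (L + 2) * (2 * δ) ≤ (1 / 32) ^ 4) :
    0 < frogLaw d p ν {ω | Survives ω} := by
  obtain ⟨A₀, hA₀, hlayer⟩ := exists_finset_layer_zero hq M
  have hgood (A : Finset (Site d)) (hA : A.card = M) : infinitePi (fun _ : Site d => siteLaw d p ν)
      {r | ¬ (frogRule d q K L M).Good A r} ≤ (1 / 32) ^ 4 := by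
    refine ((frogRule d q K L M).measure_not_good_le (siteLaw d p ν)
      (size := fun j => ⌈(1 + θ) ^ j * M⌉₊) card_child_frogRule_le (by simp [hA])
      (fun j _ V B hB hVB => ?_) fun i B hB hBs => ?_).trans hLδ
    · exact measure_child_lt_le p ν hM hθ hq hmean hcoll hchild hB (hA ▸ hVB)
    · exact measure_exit_lt_le p ν hM hθ hq hmean hcoll hexit hL i hB (hA ▸ hBs)
  obtain ⟨a, -, ha⟩ := (frogRule d q K L M).exists_pos_infinite_reachable (siteLaw d p ν) hlayer
    hA₀ hM hgood
  exact frogLaw_survives_pos p ν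
    (ha.trans_le (measure_mono fun r hr => infinite_cluster_of_leads hr))

end Survival

section Supercritical

theorem integral_natCast_pos_iff {ν : Measure ℕ} (hint : Integrable (fun n : ℕ => (n : ℝ)) ν) :
    0 < ∫ n : ℕ, (n : ℝ) ∂ν ↔ 0 < ν {n | 1 ≤ n} := by
  have hsupport : Function.support (fun n : ℕ => (n : ℝ)) = {n | 1 ≤ n} := by
    ext n
    simp [Nat.one_le_iff_ne_zero]
  rw [integral_pos_iff_support_of_nonneg (fun n => n.cast_nonneg) hint, hsupport]

theorem exists_le_stepLaw {d N : ℕ} (hN : 3 ≤ N) (hd : N ≤ d) : ∃ q : ℕ, 2 * q < d ∧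
    1 - 2 / (N : ℝ) ≤ (stepLaw d).real {z | layer d q z = 0} ∧
      ∀ i, 1 / (4 * N : ℝ) ≤ (stepLaw d).real {z | layer d q z = unitVec i} := by
  have hd0 : 0 < d := by omega
  have hd' : (0 : ℝ) < d := by exact_mod_cast hd0
  have hN' : (0 : ℝ) < N := by exact_mod_cast (by omega : 0 < N)
  have hmul : N * (d / N) ≤ d := Nat.mul_div_le d N
  have hlt : d < N * (d / N + 1) := Nat.lt_mul_div_succ d (by omega)
  have hone : 1 ≤ d / N := (Nat.one_le_div_iff (by omega)).2 hd
  have h2q : 2 * (d / N) < d := by nlinarith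
  refine ⟨d / N, h2q, le_trans ?_ (le_stepLaw_neutral hd0 h2q.le), fun i =>
    le_trans ?_ (le_stepLaw_unitVec hd0 h2q.le i)⟩
  · have h : (N : ℝ) * (d / N : ℕ) ≤ d := by exact_mod_cast hmul
    rw [sub_le_sub_iff_left, div_le_div_iff₀ hd' hN']
    linarith
  · have h : (d : ℝ) ≤ N * (2 * (d / N : ℕ)) := by
      exact_mod_cast hlt.le.trans (Nat.mul_le_mul_left N (by omega))
    rw [div_le_div_iff₀ (by positivity) (by positivity)]
    linarith

variable (p : unitInterval) (ν : Measure ℕ) [IsProbabilityMeasure ν]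

theorem siteLaw_real_runs {d : ℕ} (Z : Set (Site d)) (i n : ℕ) :
    (siteLaw d p ν).real {e | Runs Z e i n} =
      ν.real {m | i < m} * ((stepLaw d).real Z ^ n * (p : ℝ) ^ n) := by
  rw [measureReal_def, siteLaw_runs, ENNReal.toReal_mul, ENNReal.toReal_mul, ENNReal.toReal_pow,
    ENNReal.toReal_ofReal (pow_nonneg p.2.1 n), measureReal_def, measureReal_def]

theorem le_sum_siteLaw_runs {d : ℕ} {Z : Set (Site d)} {s : ℝ} (hs0 : 0 ≤ s) (hs1 : s ≤ 1)
    (hZ : s ≤ (stepLaw d).real Z) (K : ℕ) :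
    (∑ i ∈ Finset.range K, ν.real {m | i < m}) * (∑ n ∈ Finset.Icc 1 K, (p : ℝ) ^ n) * s ^ K ≤
      ∑ u ∈ Finset.range K ×ˢ Finset.Icc 1 K, (siteLaw d p ν).real {e | Runs Z e u.1 u.2} := by
  rw [Finset.sum_mul_sum, ← Finset.sum_product', Finset.sum_mul]
  refine Finset.sum_le_sum fun u hu => ?_
  have hpow : s ^ K ≤ (stepLaw d).real Z ^ u.2 :=
    (pow_le_pow_of_le_one hs0 hs1 (Finset.mem_Icc.1 (Finset.mem_product.1 hu).2).2).trans
      (by gcongr)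
  rw [siteLaw_real_runs, mul_assoc, mul_comm ((p : ℝ) ^ u.2)]
  have hp := p.2.1
  gcongr

/-- In high dimension the neutral steps are so frequent that a particle still has on average more
than one descendant in its layer, while each neighbouring layer keeps a positive frequency. -/
theorem exists_rates {p : unitInterval} {ν : Measure ℕ} [IsProbabilityMeasure ν]
    (hint : Integrable (fun n : ℕ => (n : ℝ)) ν) (hp : (p : ℝ) < 1)
    (h : 1 < p * (1 + ∫ n : ℕ, (n : ℝ) ∂ν)) :
    ∃ K : ℕ, ∃ θ > 0, ∀ᶠ d : ℕ in atTop, ∃ q : ℕ, 2 * q < d ∧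
      1 + 2 * θ ≤ ∑ u ∈ Finset.range K ×ˢ Finset.Icc 1 K,
        (siteLaw d p ν).real {e | Runs {z | layer d q z = 0} e u.1 u.2} ∧
      ∀ i, 2 * θ ≤ (siteLaw d p ν).real {e | Runs {z | layer d q z = unitVec i} e 0 1} := by
  have hp0 : 0 ≤ (p : ℝ) := p.2.1
  obtain ⟨K, hK⟩ := exists_truncation hint hp0 hp h
  set mean := (∑ i ∈ Finset.range K, ν.real {m | i < m}) * ∑ n ∈ Finset.Icc 1 K, (p : ℝ) ^ n
  have hlim : Tendsto (fun N : ℕ => mean * (1 - 2 / (N : ℝ)) ^ K) atTop (𝓝 (mean * (1 - 0) ^ K)) :=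
    ((tendsto_const_nhds.sub (tendsto_const_div_atTop_nhds_zero_nat 2)).pow K).const_mul mean
  obtain ⟨N, hN, hN3⟩ := ((hlim.eventually (lt_mem_nhds (by simpa using hK))).and
    (eventually_ge_atTop 3)).exists
  have hm : 0 < ∫ n : ℕ, (n : ℝ) ∂ν := by nlinarith
  have hp0 : 0 < (p : ℝ) := pos_of_mul_pos_left (one_pos.trans h) (by positivity)
  have hν : 0 < ν.real {m | 0 < m} :=
    ENNReal.toReal_pos ((integral_natCast_pos_iff hint).1 hm).ne' (measure_ne_top _ _)
  have hN' : (0 : ℝ) < N := by exact_mod_cast (by omega : 0 < N)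
  have hs : 2 / (N : ℝ) ≤ 1 := (div_le_one hN').2 (by exact_mod_cast (by omega : 2 ≤ N))
  let θ := min (mean * (1 - 2 / (N : ℝ)) ^ K - 1) (ν.real {m | 0 < m} * (1 / (4 * N) * p)) / 2
  refine ⟨K, θ, half_pos (lt_min (by linarith) (by positivity)), ?_⟩
  filter_upwards [eventually_ge_atTop N] with d hd
  obtain ⟨q, hq, hneutral, hunit⟩ := exists_le_stepLaw hN3 hd
  have h2θ : 2 * θ = min _ _ := mul_div_cancel₀ _ two_ne_zero
  refine ⟨q, hq, ?_, fun i => ?_⟩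
  · calc 1 + 2 * θ ≤ mean * (1 - 2 / (N : ℝ)) ^ K := by
          rw [h2θ, ← le_sub_iff_add_le']
          exact min_le_left _ _
      _ ≤ _ := le_sum_siteLaw_runs p ν (by linarith) (by linarith [div_pos two_pos hN']) hneutral K
  · rw [siteLaw_real_runs, pow_one, pow_one, h2θ]
    refine (min_le_right _ _).trans ?_
    gcongr
    exact hunit i

theorem eventually_natCast_mul_inv_le (C : ℕ) {δ : ℝ≥0∞} (hδ : 0 < δ) :
    ∀ᶠ d : ℕ in atTop, C * ((2 * d : ℕ) : ℝ≥0∞)⁻¹ ≤ δ := by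
  have hdouble : Tendsto (fun d : ℕ => 2 * d) atTop atTop := tendsto_id.const_mul_atTop' two_pos
  have h := ENNReal.Tendsto.const_mul (a := (C : ℝ≥0∞))
    (ENNReal.tendsto_inv_nat_nhds_zero.comp hdouble) (.inr (ENNReal.natCast_ne_top C))
  rw [mul_zero] at h
  exact (h.eventually (gt_mem_nhds hδ)).mono fun d hd => hd.le

theorem eventually_ofReal_div_le (C : ℝ) {a : ℝ} (ha : 0 < a) {δ : ℝ≥0∞} (hδ : 0 < δ) :
    ∀ᶠ M : ℕ in atTop, ENNReal.ofReal (C / (a * M)) ≤ δ := by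
  have h : Tendsto (fun M : ℕ => ENNReal.ofReal (C / (a * M))) atTop (𝓝 (ENNReal.ofReal 0)) :=
    ENNReal.tendsto_ofReal
      (tendsto_const_nhds.div_atTop (tendsto_natCast_atTop_atTop.const_mul_atTop ha))
  rw [ENNReal.ofReal_zero] at h
  exact (h.eventually (gt_mem_nhds hδ)).mono fun M hM => hM.le

theorem eventually_survives_pos {p : unitInterval} {ν : Measure ℕ} [IsProbabilityMeasure ν]
    (hint : Integrable (fun n : ℕ => (n : ℝ)) ν) (hp : (p : ℝ) < 1)
    (h : 1 < p * (1 + ∫ n : ℕ, (n : ℝ) ∂ν)) :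
    ∀ᶠ d : ℕ in atTop, 0 < frogLaw d p ν {ω | Survives ω} := by
  obtain ⟨K, θ, hθ, hrates⟩ := exists_rates hint hp h
  obtain ⟨L, hL⟩ : ∃ L : ℕ, 1 / θ < (1 + θ) ^ L := pow_unbounded_of_one_lt _ (by linarith)
  rw [div_lt_iff₀' hθ] at hL
  obtain ⟨δ, hδ, hLδ⟩ : ∃ δ : ℝ≥0∞, 0 < δ ∧ (L + 2) * (2 * δ) ≤ (1 / 32) ^ 4 := by
    refine ⟨(1 / 32) ^ 4 / ((L + 2) * 2), ENNReal.div_pos (by simp) (by finiteness), ?_⟩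
    rw [← mul_assoc]
    exact ENNReal.mul_div_le
  obtain ⟨M, hmean, hM⟩ := ((eventually_ofReal_div_le (((1 + K * K : ℕ) : ℝ) ^ 2) (pow_pos hθ 2)
    hδ).and (eventually_gt_atTop 0)).exists
  filter_upwards [hrates, eventually_natCast_mul_inv_le _ hδ] with d ⟨q, hq, hchild, hexit⟩ hcoll
  exact frogLaw_survives_pos_of_rates p ν hM hθ hq hmean hcoll hchild hexit hL.le hLδ

end Supercritical

section AvoidingPath

variable {d : ℕ}

/-- There is a chain of `n` visits from `x` to `y` whose sites are distinct and, after `x`,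
outside `S`. The sites passed so far are carried in `S`, so that the rest of the chain involves
only the data at other sites. -/
def AvoidingPath (r : Site d → SiteData d) : ℕ → Site d → Site d → Set (Site d) → Prop
  | 0, x, y, _ => x = y
  | n + 1, x, y, S => ∃ z ∉ insert x S, Visits (r x) x z ∧ AvoidingPath r n z y (insert x S)

theorem setOf_avoidingPath_succ (n : ℕ) (x y : Site d) (S : Set (Site d)) :
    {r | AvoidingPath r (n + 1) x y S} = ⋃ z : ((insert x S)ᶜ : Set (Site d)),
      {r | Visits (r x) x z} ∩ {r | AvoidingPath r n z y (insert x S)} := by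
  ext r
  simp [AvoidingPath, and_left_comm]

theorem measurableSet_visits_eval (x y : Site d) :
    MeasurableSet {r : Site d → SiteData d | Visits (r x) x y} :=
  (measurable_pi_apply x : Measurable fun r : Site d → SiteData d => r x) (measurableSet_visits x y)

theorem measurableSet_avoidingPath (n : ℕ) (x y : Site d) (S : Set (Site d)) :
    MeasurableSet {r | AvoidingPath r n x y S} := by
  induction n generalizing x S with
  | zero => exact .const _
  | succ n ih =>
    rw [setOf_avoidingPath_succ]
    exact .iUnion fun z => (measurableSet_visits_eval x z).inter (ih _ _)

theorem dependsOn_visits (x y : Site d) :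
    DependsOn (· ∈ {r : Site d → SiteData d | Visits (r x) x y}) {x} := by
  intro r r' h
  simp only [Set.mem_ofPred_eq, h x rfl]

theorem dependsOn_avoidingPath (n : ℕ) {x : Site d} (y : Site d) {S : Set (Site d)} (hx : x ∉ S) :
    DependsOn (· ∈ {r | AvoidingPath r n x y S}) Sᶜ := by
  intro r r' h
  simp only [Set.mem_ofPred_eq]
  induction n generalizing x S with
  | zero => rfl
  | succ n ih =>
    simp only [AvoidingPath, h x hx]
    refine propext (exists_congr fun z => and_congr_right fun hz => and_congr_right fun _ => ?_)
    exact iff_of_eq (ih hz fun w hw => h w fun hS => hw (Set.mem_insert_of_mem x hS))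

theorem exists_avoidingPath {r : Site d → SiteData d} {x y : Site d} (h : y ∈ cluster r x) :
    ∃ n, AvoidingPath r n x y ∅ := by
  obtain ⟨n, f, rfl, rfl, hstep, hinj⟩ := exists_injOn_path h
  have hpath (m k : ℕ) (hk : k + m = n) : AvoidingPath r m (f k) (f n) (f '' Set.Iio k) := by
    induction m generalizing k with
    | zero => exact congrArg f hk
    | succ m ih =>
      have hins : insert (f k) (f '' Set.Iio k) = f '' Set.Iio (k + 1) := by
        rw [← Set.image_insert_eq, Set.Iio_insert, Set.Iio_add_one_eq_Iic]
      simp only [AvoidingPath, hins]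
      refine ⟨f (k + 1), ?_, hstep k (by omega), ih (k + 1) (by omega)⟩
      rintro ⟨j, hj, hjk⟩
      have hj : j < k + 1 := hj
      have := hinj (Set.mem_Iic.2 (by omega)) (Set.mem_Iic.2 (by omega)) hjk
      omega
  exact ⟨n, by simpa using hpath n 0 (zero_add n)⟩

end AvoidingPath

section ExpectedVisits

variable {d : ℕ} {p : unitInterval} {ν : Measure ℕ} [IsProbabilityMeasure ν]

theorem siteLaw_visits_le {x y : Site d} (h : y ≠ x) : siteLaw d p ν {e | Visits e x y} ≤
    ∑' (i : ℕ) (n : ℕ),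
      siteLaw d p ν ({e | Runs Set.univ e i (n + 1)} ∩ {e | x + displ e i (n + 1) = y}) := by
  refine (measure_mono ?_).trans ((measure_iUnion_le _).trans
    (ENNReal.tsum_le_tsum fun i => measure_iUnion_le _))
  rintro e ⟨i, n, hrun, hy⟩
  obtain _ | n := n
  · exact absurd (by simpa [displ] using hy.symm) h
  · exact Set.mem_iUnion₂.2 ⟨i, n, hrun, hy⟩

theorem tsum_siteLaw_runs_inter_le (x : Site d) (i n : ℕ) :
    ∑' y, siteLaw d p ν ({e | Runs Set.univ e i n} ∩ {e | x + displ e i n = y}) ≤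
      ν {m | i < m} * ENNReal.ofReal ((p : ℝ) ^ n) := by
  have hendpoint : Measurable fun e : SiteData d => x + displ e i n := by fun_prop
  calc ∑' y, siteLaw d p ν ({e | Runs Set.univ e i n} ∩ {e | x + displ e i n = y})
      ≤ siteLaw d p ν (⋃ y, {e | Runs Set.univ e i n} ∩ {e | x + displ e i n = y}) :=
        tsum_meas_le_meas_iUnion_of_disjoint _
          (fun y => (measurableSet_runs _ i n).inter (hendpoint (.singleton y)))
          fun y z hyz => Set.disjoint_left.2 fun e hy hz => hyz (hy.2.symm.trans hz.2)
    _ ≤ siteLaw d p ν {e | Runs Set.univ e i n} :=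
        measure_mono (Set.iUnion_subset fun y => Set.inter_subset_left)
    _ = ν {m | i < m} * ENNReal.ofReal ((p : ℝ) ^ n) := by
        rw [siteLaw_runs, measure_univ, one_pow, one_mul]

theorem tsum_ofReal_pow_succ {x : ℝ} (h0 : 0 ≤ x) (h1 : x < 1) :
    ∑' n : ℕ, ENNReal.ofReal (x ^ (n + 1)) = ENNReal.ofReal (x / (1 - x)) := by
  have hsum := (hasSum_geometric_of_lt_one h0 h1).mul_left x
  simp only [← pow_succ', ← div_eq_mul_inv] at hsum
  rw [← hsum.tsum_eq, ENNReal.ofReal_tsum_of_nonneg (fun n => pow_nonneg h0 _) hsum.summable]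

theorem tsum_siteLaw_visits_le (hint : Integrable (fun n : ℕ => (n : ℝ)) ν) (hp : (p : ℝ) < 1)
    (x : Site d) : ∑' y : ({x}ᶜ : Set (Site d)), siteLaw d p ν {e | Visits e x y} ≤
      ENNReal.ofReal ((∫ n : ℕ, (n : ℝ) ∂ν) * (p / (1 - p))) := by
  let F (y : Site d) (i n : ℕ) : ℝ≥0∞ :=
    siteLaw d p ν ({e | Runs Set.univ e i (n + 1)} ∩ {e | x + displ e i (n + 1) = y})
  calc ∑' y : ({x}ᶜ : Set (Site d)), siteLaw d p ν {e | Visits e x y}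
      ≤ ∑' y : ({x}ᶜ : Set (Site d)), ∑' (i : ℕ) (n : ℕ), F y i n :=
        ENNReal.tsum_le_tsum fun y => siteLaw_visits_le y.2
    _ ≤ ∑' (y : Site d) (i : ℕ) (n : ℕ), F y i n :=
        ENNReal.tsum_comp_le_tsum_of_injective Subtype.val_injective fun y => ∑' (i) (n), F y i n
    _ = ∑' (i : ℕ) (n : ℕ) (y : Site d), F y i n := by
        rw [ENNReal.tsum_comm]
        exact tsum_congr fun i => ENNReal.tsum_comm
    _ ≤ ∑' (i : ℕ) (n : ℕ), ν {m | i < m} * ENNReal.ofReal ((p : ℝ) ^ (n + 1)) :=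
        ENNReal.tsum_le_tsum fun i => ENNReal.tsum_le_tsum fun n =>
          tsum_siteLaw_runs_inter_le x i (n + 1)
    _ = ENNReal.ofReal ((∫ n : ℕ, (n : ℝ) ∂ν) * (p / (1 - p))) := by
        simp only [ENNReal.tsum_mul_left, ENNReal.tsum_mul_right]
        rw [tsum_measure_lt hint, tsum_ofReal_pow_succ p.2.1 hp,
          ← ENNReal.ofReal_mul (integral_nonneg fun n => n.cast_nonneg)]

end ExpectedVisits

section Extinction

variable {d : ℕ} {p : unitInterval} {ν : Measure ℕ} [IsProbabilityMeasure ν]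

theorem measure_avoidingPath_succ_le (n : ℕ) (x y : Site d) (S : Set (Site d)) :
    infinitePi (fun _ : Site d => siteLaw d p ν) {r | AvoidingPath r (n + 1) x y S} ≤
      ∑' z : ((insert x S)ᶜ : Set (Site d)), siteLaw d p ν {e | Visits e x z} *
        infinitePi (fun _ : Site d => siteLaw d p ν) {r | AvoidingPath r n z y (insert x S)} := by
  rw [setOf_avoidingPath_succ]
  refine (measure_iUnion_le _).trans (ENNReal.tsum_le_tsum fun z => le_of_eq ?_)
  have hvisits := (measurePreserving_eval_infinitePi (fun _ : Site d => siteLaw d p ν)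
    x).measure_preimage (measurableSet_visits x z).nullMeasurableSet
  rw [infinitePi_inter_of_dependsOn _ (measurableSet_visits_eval x z)
    (measurableSet_avoidingPath n z y _) (by simp) (dependsOn_visits x z)
    (dependsOn_avoidingPath n y (Set.notMem_of_mem_compl z.2)), ← hvisits]
  rfl

theorem tsum_measure_avoidingPath_le {lam : ℝ≥0∞}
    (h : ∀ x : Site d, ∑' y : ({x}ᶜ : Set (Site d)), siteLaw d p ν {e | Visits e x y} ≤ lam)
    (n : ℕ) (x : Site d) (S : Set (Site d)) :
    ∑' y, infinitePi (fun _ : Site d => siteLaw d p ν) {r | AvoidingPath r n x y S} ≤ lam ^ n := by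
  induction n generalizing x S with
  | zero =>
    rw [tsum_eq_single x fun y hy => by simp [AvoidingPath, hy.symm], pow_zero]
    exact prob_le_one
  | succ n ih =>
    set μ := infinitePi fun _ : Site d => siteLaw d p ν
    let T : Set (Site d) := (insert x S)ᶜ
    have hT : T ⊆ {x}ᶜ := Set.compl_subset_compl.2 (by simp)
    calc ∑' y, μ {r | AvoidingPath r (n + 1) x y S}
        ≤ ∑' y, ∑' z : T, siteLaw d p ν {e | Visits e x z} *
            μ {r | AvoidingPath r n z y (insert x S)} :=
          ENNReal.tsum_le_tsum fun y => measure_avoidingPath_succ_le n x y S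
      _ = ∑' z : T, siteLaw d p ν {e | Visits e x z} *
            ∑' y, μ {r | AvoidingPath r n z y (insert x S)} := by
          rw [ENNReal.tsum_comm]
          simp only [ENNReal.tsum_mul_left]
      _ ≤ ∑' z : T, siteLaw d p ν {e | Visits e x z} * lam ^ n :=
          ENNReal.tsum_le_tsum fun z => by gcongr; exact ih z _
      _ = (∑' z : T, siteLaw d p ν {e | Visits e x z}) * lam ^ n := ENNReal.tsum_mul_right
      _ ≤ lam * lam ^ n := by
          gcongr
          exact (ENNReal.tsum_mono_subtype (fun z => siteLaw d p ν {e | Visits e x z}) hT).trans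
            (h x)
      _ = lam ^ (n + 1) := (pow_succ' lam n).symm

theorem ae_finite_cluster {lam : ℝ≥0∞} (hlam : lam < 1)
    (h : ∀ x : Site d, ∑' y : ({x}ᶜ : Set (Site d)), siteLaw d p ν {e | Visits e x y} ≤ lam)
    (x : Site d) : ∀ᵐ r ∂infinitePi fun _ : Site d => siteLaw d p ν, (cluster r x).Finite := by
  set μ := infinitePi fun _ : Site d => siteLaw d p ν
  have hsum : ∑' y, μ {r | y ∈ cluster r x} ≠ ⊤ := by
    refine ne_top_of_le_ne_top (b := (1 - lam)⁻¹) (by simpa [tsub_eq_zero_iff_le] using hlam) ?_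
    calc ∑' y, μ {r | y ∈ cluster r x}
        ≤ ∑' (y : Site d) (n : ℕ), μ {r | AvoidingPath r n x y ∅} :=
          ENNReal.tsum_le_tsum fun y => (measure_mono fun r (hr : y ∈ cluster r x) =>
            Set.mem_iUnion.2 (exists_avoidingPath hr)).trans
              (measure_iUnion_le fun n => {r | AvoidingPath r n x y ∅})
      _ = ∑' (n : ℕ) (y : Site d), μ {r | AvoidingPath r n x y ∅} := ENNReal.tsum_comm
      _ ≤ ∑' n : ℕ, lam ^ n :=
          ENNReal.tsum_le_tsum fun n => tsum_measure_avoidingPath_le h n x ∅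
      _ = (1 - lam)⁻¹ := ENNReal.tsum_geometric lam
  exact ae_finite_setOfPred_mem hsum

theorem ae_lifetime_lt_top (hp : p ≠ 1) :
    ∀ᵐ ω ∂frogLaw d p ν, ∀ x i, lifetime ω x i < ⊤ := by
  refine ae_all_iff.2 fun x => ae_all_iff.2 fun i => ?_
  have hlife : MeasurePreserving (fun ω : Config d => ω.2.2 (x, i)) (frogLaw d p ν)
      (lifetimeLaw p) :=
    (measurePreserving_eval_infinitePi (fun _ : Site d × ℕ => lifetimeLaw p) (x, i)).comp
      (measurePreserving_snd.comp measurePreserving_snd)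
  refine hlife.quasiMeasurePreserving.ae (p := fun t => t < ⊤) (ae_iff.2 ?_)
  simpa using lifetimeLaw_top hp

theorem frogLaw_survives_eq_zero (hint : Integrable (fun n : ℕ => (n : ℝ)) ν)
    (h : (p : ℝ) * (1 + ∫ n : ℕ, (n : ℝ) ∂ν) < 1) : frogLaw d p ν {ω | Survives ω} = 0 := by
  have hm : 0 ≤ ∫ n : ℕ, (n : ℝ) ∂ν := integral_nonneg fun n => n.cast_nonneg
  have hp : (p : ℝ) < 1 := by nlinarith [p.2.1]
  have hp1 : p ≠ 1 := fun h => by simp [h] at hp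
  have hlam : ENNReal.ofReal ((∫ n : ℕ, (n : ℝ) ∂ν) * (p / (1 - p))) < 1 := by
    rw [ENNReal.ofReal_lt_one, ← mul_div_assoc, div_lt_one (by linarith)]
    linarith
  have hfin : ∀ᵐ ω ∂frogLaw d p ν, (cluster (toField ω) 0).Finite :=
    (measurePreserving_toField d p ν).quasiMeasurePreserving.ae
      (ae_finite_cluster hlam (tsum_siteLaw_visits_le hint hp) 0)
  refine measure_mono_null (fun ω hω => ?_)
    (ae_iff.1 (hfin.and (ae_lifetime_lt_top (d := d) (ν := ν) hp1)))
  rintro ⟨hcluster, hlife⟩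
  refine infinite_of_survives hlife hω (hcluster.subset fun y hy => ?_)
  simpa only [cluster, Set.mem_ofPred_eq, visits_toField_iff] using
    reachable_iff_activationTime_lt_top.2 hy

end Extinction

section CriticalParam

variable {d : ℕ} {p : unitInterval} {ν : Measure ℕ} [IsProbabilityMeasure ν]

theorem le_criticalParam (hint : Integrable (fun n : ℕ => (n : ℝ)) ν)
    (h : 0 < frogLaw d p ν {ω | Survives ω}) :
    1 / (1 + ∫ n : ℕ, (n : ℝ) ∂ν) ≤ criticalParam d ν := by
  have hm : 0 ≤ ∫ n : ℕ, (n : ℝ) ∂ν := integral_nonneg fun n => n.cast_nonneg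
  refine le_csInf ⟨p, p.2, h⟩ ?_
  rintro x ⟨hx, hs⟩
  by_contra! hlt
  rw [lt_div_iff₀ (by positivity)] at hlt
  exact hs.ne' (frogLaw_survives_eq_zero (p := ⟨x, hx⟩) hint hlt)

theorem criticalParam_le (h : 0 < frogLaw d p ν {ω | Survives ω}) : criticalParam d ν ≤ p :=
  csInf_le ⟨0, fun _ hx => hx.1.1⟩ ⟨p.2, h⟩

theorem eventually_criticalParam_mem_Icc (hint : Integrable (fun n : ℕ => (n : ℝ)) ν) {x : ℝ}
    (hx : x ∈ Set.Ioo (1 / (1 + ∫ n : ℕ, (n : ℝ) ∂ν)) 1) :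
    ∀ᶠ d in atTop, criticalParam d ν ∈ Set.Icc (1 / (1 + ∫ n : ℕ, (n : ℝ) ∂ν)) x := by
  have hm : 0 ≤ ∫ n : ℕ, (n : ℝ) ∂ν := integral_nonneg fun n => n.cast_nonneg
  have hx0 : 0 ≤ x := (one_div_nonneg.2 (by positivity)).trans hx.1.le
  let p : unitInterval := ⟨x, hx0, hx.2.le⟩
  filter_upwards [eventually_survives_pos (p := p) hint hx.2
    ((div_lt_iff₀ (by positivity)).1 hx.1)] with d hd
  exact ⟨le_criticalParam hint hd, criticalParam_le hd⟩

end CriticalParam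

end Frog

theorem theorem2p8 (ν : Measure ℕ) [IsProbabilityMeasure ν]
    (hpos : 0 < ν {n : ℕ | 1 ≤ n})
    (hint : Integrable (fun n : ℕ => (n : ℝ)) ν) :
    Tendsto (fun d : ℕ => Frog.criticalParam d ν) atTop
      (𝓝 (1 / (1 + ∫ n : ℕ, (n : ℝ) ∂ν))) := by
  have hm : 0 < ∫ n : ℕ, (n : ℝ) ∂ν := (Frog.integral_natCast_pos_iff hint).2 hpos
  have hlt : 1 / (1 + ∫ n : ℕ, (n : ℝ) ∂ν) < 1 := by
    rw [div_lt_one (by positivity)]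
    linarith
  refine tendsto_order.2 ⟨fun a ha => ?_, fun a ha => ?_⟩
  · obtain ⟨x, hx⟩ := exists_between hlt
    filter_upwards [Frog.eventually_criticalParam_mem_Icc hint hx] with d hd
    exact ha.trans_le hd.1
  · obtain ⟨x, hx, hxa⟩ := exists_between (lt_min ha hlt)
    filter_upwards [Frog.eventually_criticalParam_mem_Icc hint
      ⟨hx, hxa.trans_le (min_le_right _ _)⟩] with d hd
    exact hd.2.trans_lt (hxa.trans_le (min_le_left _ _))
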